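/- Let $V:\mathbb R\to\mathbb R$ be smooth and even, $V=V_{\rm per}+V_{\rm def}$, where $V_{\rm per}(x+1)=V_{\rm per}(x)$ for all $x$ and $V_{\rm def}(x)=0$ for $|x|>\rho$, for some $\rho\ge 0$. Let $E>0$ and let $\Phi\in L^2(\mathbb R)$, $\Phi\neq 0$, satisfy $-\Phi''+V\Phi=E\Phi$ (a bound state of $H=D_x^2+V$, $D_x=-i\,d/dx$). Then $\Phi$ is even or odd. For $z\in\mathbb C$ let $u_z$ be the solution of $-u_z''+Vu_z=zu_z$ with $u_z(0)=1,\ u_z'(0)=0$ if $\Phi$ is even, and $u_z(0)=0,\ u_z'(0)=1$ if $\Phi$ is odd. For $M>0$ put $$\Theta(z)=\Theta_M(z)=u_z'(M)-i\sqrt z\,u_z(M),$$ with the principal branch of the square root. The periodic equation $-y''+V_{\rm per}y=Ey$ has real Floquet multipliers $\mu,\mu^{-1}$ with $|\mu|>1$ (that is, nonzero solutions with $y(x+1)=\mu^{\pm1}y(x)$ for all $x$); let $\kappa=\log|\mu|>0$. For every $k$ with $0<k<\kappa$ (in particular for some $k>0$) there is $M_0>\rho$ such that for all real $M\ge M_0$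 one has $\partial_z\Theta(E)\ne0$ and: 1. $\Theta$ has a unique root $z^*$ in the ball $\Omega_M=\{z\in\mathbb C:\ |z-E|\le M^{-2}e^{-kM}\}$; 2. $z^*=E-\dfrac{\Theta(E)}{\partial_z\Theta(E)}+O(e^{-4kM})$, with an implied constant independent of $M$. For $k=\kappa$ the same holds with the error in (2) replaced by $O(M e^{-4\kappa M})$. -/

import Mathlib

open scoped ContDiff

/-- `u` is a classical solution on `ℝ` of the Schrödinger equation `(D_x² + V - z) u = 0`, where
`D_x = -i d/dx`, that is, of `-u'' + V u = z u`. -/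
def SolvesSchrodinger (V : ℝ → ℝ) (z : ℂ) (u : ℝ → ℂ) : Prop :=
  ContDiff ℝ 2 u ∧ ∀ x : ℝ, -(deriv (deriv u) x) + (V x : ℂ) * u x = z * u x

/-- `Φ` is a bound state of `H = D_x² + V` with energy `E`: a nonzero square-integrable solution
of `H Φ = E Φ`. -/
def IsBoundState (V : ℝ → ℝ) (E : ℝ) (Φ : ℝ → ℂ) : Prop :=
  SolvesSchrodinger V (E : ℂ) Φ ∧ MeasureTheory.MemLp Φ 2 MeasureTheory.volume ∧ Φ ≠ 0

/-- `μ` is a (real) Floquet multiplier at energy `E` of the Schrödinger equation with 1-periodic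
potential `W`: some nonzero solution is multiplied by `μ` under translation by one period. -/
def IsFloquetMultiplier (W : ℝ → ℝ) (E μ : ℝ) : Prop :=
  ∃ y : ℝ → ℂ, SolvesSchrodinger W (E : ℂ) y ∧ y ≠ 0 ∧ ∀ x : ℝ, y (x + 1) = (μ : ℂ) * y x

/-- `Θ(z) = u_z'(M) - i √z u_z(M)` for a family `z ↦ u_z`, with the principal square root. -/
noncomputable def outgoingTheta (u : ℂ → ℝ → ℂ) (M : ℝ) (z : ℂ) : ℂ :=
  deriv (u z) M - Complex.I * Complex.sqrt z * u z M

/-- `Θ` has exactly one zero `z*` in the closed ball of radius `r` about `E`, one has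
`∂_z Θ(E) ≠ 0` (in particular `Θ` is complex differentiable at `E`), and
`|z* - (E - Θ(E) / ∂_z Θ(E))| ≤ err`. -/
def HasUniqueRootNear (Θ : ℂ → ℂ) (E r err : ℝ) : Prop :=
  deriv Θ (E : ℂ) ≠ 0 ∧
  ∃ zs : ℂ, ‖zs - (E : ℂ)‖ ≤ r ∧ Θ zs = 0 ∧
    (∀ w : ℂ, ‖w - (E : ℂ)‖ ≤ r → Θ w = 0 → w = zs) ∧
    ‖zs - ((E : ℂ) - Θ (E : ℂ) / deriv Θ (E : ℂ))‖ ≤ err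

/-! The root is found by a Newton iteration at `E`, so everything reduces to three estimates on `Θ`
for large `M`.

The function is small at `E`: the normalized bound state `u = u_E` tends to zero with its
derivative. Where the potential is periodic, `u` and its translate by one period have constant
Wronskian, which tends to zero, so they are proportional and `u` is a decaying Floquet solution.
Reflection supplies the growing one (`IsSolOn.exists_floquet`). Hence `Θ(E) = O(e^{-κM})`.

The derivative is large: with `w`, `w'` the `z`-derivatives of `u_z(M)`, `u_z'(M)` at `E`,
Lagrange's identity reads `u w' - u' w = -∫₀ᴹ u²`. The right side stays away from zero while `u`,
`u'` are `O(e^{-κM})`, so `w` or `w'` is at least of order `e^{κM}`. Both are real, so `w' - i√E w`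
has no cancellation (`IsSolFamily.exists_le_norm_deriv_outgoingTheta`).

The variation is controlled: variation of constants along a decaying and an at most growing solution
gives `|Θ(z) - Θ(E)| ≤ C e^{κM} |z - E|` for `|z - E| ≤ ε/M`
(`IsSolFamily.exists_norm_outgoingTheta_sub_le`). Cauchy's estimates turn this into a bound `O(M
e^{κM})` for the second derivative.

The Newton step is thus `O(e^{-2κM})`, and its error, of order `|Θ''/Θ'|` times the square of the
step, is `O(M e^{-4κM})` (`hasUniqueRootNear_of_norm_sub_le`). For `k < κ` the factor `M` is
absorbed by the gap in the exponents. -/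

/-! ### Global solvability of linear initial value problems. -/

/-- The weight `exp (2 |∫ m|)` dominates twice the integral of itself against `m`. -/
theorem abs_integral_exp_two_abs_mul_le {m : ℝ → ℝ} (hm : Continuous m) (hm0 : ∀ t, 0 ≤ m t)
    (x₀ x : ℝ) :
    |∫ t in x₀..x, Real.exp (2 * |∫ s in x₀..t, m s|) * m t| ≤
      Real.exp (2 * |∫ s in x₀..x, m s|) / 2 := by
  have hθ : ∀ t, HasDerivAt (fun t => ∫ s in x₀..t, m s) (m t) t := fun t =>
    (hm.integral_hasStrictDerivAt x₀ t).hasDerivAt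
  have hcont : Continuous fun t => ∫ s in x₀..t, m s :=
    continuous_iff_continuousAt.2 fun t => (hθ t).continuousAt
  rcases le_total x₀ x with h | h
  · have e : ∫ t in x₀..x, Real.exp (2 * |∫ s in x₀..t, m s|) * m t =
        ∫ t in x₀..x, Real.exp (2 * ∫ s in x₀..t, m s) * m t := by
      refine intervalIntegral.integral_congr fun t ht => ?_
      rw [Set.uIcc_of_le h] at ht
      rw [abs_of_nonneg (intervalIntegral.integral_nonneg ht.1 fun s _ => hm0 s)]
    have hd : ∀ t ∈ Set.uIcc x₀ x, HasDerivAt (fun t => Real.exp (2 * ∫ s in x₀..t, m s) / 2)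
        (Real.exp (2 * ∫ s in x₀..t, m s) * m t) t := fun t _ =>
      (((hθ t).const_mul 2).exp.div_const 2).congr_deriv (by ring)
    rw [e, intervalIntegral.integral_eq_sub_of_hasDerivAt hd
      ((by fun_prop : Continuous _).intervalIntegrable _ _),
      abs_of_nonneg (intervalIntegral.integral_nonneg h fun s _ => hm0 s)]
    have h0 : 0 ≤ ∫ s in x₀..x, m s := intervalIntegral.integral_nonneg h fun s _ => hm0 s
    have h1 : 1 ≤ Real.exp (2 * ∫ s in x₀..x, m s) := Real.one_le_exp (by positivity)
    simp only [intervalIntegral.integral_same, mul_zero, Real.exp_zero]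
    rw [abs_of_nonneg (by linarith)]
    linarith
  · have hnp : ∀ t ≤ x₀, ∫ s in x₀..t, m s ≤ 0 := fun t ht => by
      rw [intervalIntegral.integral_symm]
      exact neg_nonpos.2 (intervalIntegral.integral_nonneg ht fun s _ => hm0 s)
    have e : ∫ t in x₀..x, Real.exp (2 * |∫ s in x₀..t, m s|) * m t =
        ∫ t in x₀..x, Real.exp (2 * -∫ s in x₀..t, m s) * m t := by
      refine intervalIntegral.integral_congr fun t ht => ?_
      rw [Set.uIcc_of_ge h] at ht
      rw [abs_of_nonpos (hnp t ht.2)]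
    have hd : ∀ t ∈ Set.uIcc x₀ x, HasDerivAt (fun t => -Real.exp (2 * -∫ s in x₀..t, m s) / 2)
        (Real.exp (2 * -∫ s in x₀..t, m s) * m t) t := fun t _ =>
      (((hθ t).fun_neg.const_mul 2).exp.fun_neg.div_const 2).congr_deriv (by ring)
    rw [e, intervalIntegral.integral_eq_sub_of_hasDerivAt hd
      ((by fun_prop : Continuous _).intervalIntegrable _ _), abs_of_nonpos (hnp x h)]
    have h1 : 1 ≤ Real.exp (2 * -∫ s in x₀..x, m s) :=
      Real.one_le_exp (by linarith [hnp x h])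
    simp only [intervalIntegral.integral_same, neg_zero, mul_zero, Real.exp_zero]
    rw [abs_of_nonpos (by linarith)]
    linarith

/-- Global existence for the linear initial value problem `y' = A(x) y`, `y(x₀) = y₀`. -/
theorem exists_forall_hasDerivAt_linear {F : Type*} [NormedAddCommGroup F] [NormedSpace ℝ F]
    [CompleteSpace F] {A : ℝ → F →L[ℝ] F} (hA : Continuous A) (x₀ : ℝ) (y₀ : F) :
    ∃ y : ℝ → F, y x₀ = y₀ ∧ ∀ x, HasDerivAt y (A x (y x)) x := by
  have hm : Continuous fun t => ‖A t‖ := hA.norm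
  -- Bielecki weight: writing `y = w • h` with `h` bounded makes the Picard map a contraction with
  -- constant `1/2` on the whole line at once, so no gluing of local solutions is needed.
  set w : ℝ → ℝ := fun x => Real.exp (2 * |∫ s in x₀..x, ‖A s‖|) with hw
  have hθ : Continuous fun t => ∫ s in x₀..t, ‖A s‖ := continuous_iff_continuousAt.2 fun t =>
    (hm.integral_hasStrictDerivAt x₀ t).hasDerivAt.continuousAt
  have hwc : Continuous w := by fun_prop
  have hw1 : ∀ x, 1 ≤ w x := fun x => Real.one_le_exp (by positivity)
  have hw0 : ∀ x, 0 < w x := fun x => Real.exp_pos _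
  have hintegral : ∀ h : BoundedContinuousFunction ℝ F, Continuous fun t => w t • A t (h t) :=
    fun h => hwc.smul (hA.clm_apply h.continuous)
  have hderiv : ∀ (h : BoundedContinuousFunction ℝ F) (x : ℝ),
      HasDerivAt (fun x => ∫ t in x₀..x, w t • A t (h t)) (w x • A x (h x)) x := fun h x =>
    ((hintegral h).integral_hasStrictDerivAt x₀ x).hasDerivAt
  have hbound : ∀ (h : BoundedContinuousFunction ℝ F) (x : ℝ),
      ‖(w x)⁻¹ • ∫ t in x₀..x, w t • A t (h t)‖ ≤ 1 / 2 * ‖h‖ := fun h x => by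
    rw [norm_smul, norm_inv, Real.norm_of_nonneg (hw0 x).le, inv_mul_le_iff₀ (hw0 x)]
    calc ‖∫ t in x₀..x, w t • A t (h t)‖ ≤ |∫ t in x₀..x, ‖h‖ * (w t * ‖A t‖)| := by
          refine intervalIntegral.norm_integral_le_abs_of_norm_le ?_
            ((continuous_const.mul (hwc.mul hm)).intervalIntegrable _ _)
          refine Filter.Eventually.of_forall fun t => ?_
          rw [norm_smul, Real.norm_of_nonneg (hw0 t).le]
          calc w t * ‖A t (h t)‖ ≤ w t * (‖A t‖ * ‖h‖) := by
                have := (A t).le_opNorm_of_le (h.norm_coe_le_norm t)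
                have := (hw0 t).le
                gcongr
            _ = ‖h‖ * (w t * ‖A t‖) := by ring
      _ = ‖h‖ * |∫ t in x₀..x, w t * ‖A t‖| := by
          rw [intervalIntegral.integral_const_mul, abs_mul, abs_of_nonneg (norm_nonneg h)]
      _ ≤ ‖h‖ * (w x / 2) := by
          gcongr
          exact abs_integral_exp_two_abs_mul_le hm (fun t => norm_nonneg _) x₀ x
      _ = w x * (1 / 2 * ‖h‖) := by ring
  let T : BoundedContinuousFunction ℝ F → BoundedContinuousFunction ℝ F := fun h =>
    BoundedContinuousFunction.ofNormedAddCommGroup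
      (fun x => (w x)⁻¹ • (y₀ + ∫ t in x₀..x, w t • A t (h t)))
      ((hwc.inv₀ fun x => (hw0 x).ne').smul (continuous_const.add
        (continuous_iff_continuousAt.2 fun x => (hderiv h x).continuousAt)))
      (‖y₀‖ + 1 / 2 * ‖h‖) (fun x => by
        rw [smul_add]
        refine (norm_add_le _ _).trans (add_le_add ?_ (hbound h x))
        rw [norm_smul, norm_inv, Real.norm_of_nonneg (hw0 x).le]
        exact mul_le_of_le_one_left (norm_nonneg _) (inv_le_one_of_one_le₀ (hw1 x)))
  have hT : ContractingWith (1 / 2) T := by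
    refine ⟨by norm_num, LipschitzWith.of_dist_le_mul fun g h => ?_⟩
    rw [dist_eq_norm, dist_eq_norm]
    refine (BoundedContinuousFunction.norm_le (by positivity)).2 fun x => ?_
    have e : (T g - T h) x = (w x)⁻¹ • ∫ t in x₀..x, w t • A t ((g - h) t) := by
      simp only [T, BoundedContinuousFunction.coe_sub, Pi.sub_apply, map_sub, smul_sub,
        BoundedContinuousFunction.coe_ofNormedAddCommGroup, smul_add]
      rw [intervalIntegral.integral_sub ((hintegral g).intervalIntegrable _ _)
        ((hintegral h).intervalIntegrable _ _), smul_sub]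
      abel
    rw [e]
    simpa using hbound (g - h) x
  set h := ContractingWith.fixedPoint T hT
  have hfix : ∀ x, h x = (w x)⁻¹ • (y₀ + ∫ t in x₀..x, w t • A t (h t)) := fun x =>
    (DFunLike.congr_fun hT.fixedPoint_isFixedPt x).symm
  have hwh : ∀ x, w x • h x = y₀ + ∫ t in x₀..x, w t • A t (h t) := fun x => by
    rw [hfix x, smul_inv_smul₀ (hw0 x).ne']
  refine ⟨fun x => w x • h x, by simp [hwh], fun x => ?_⟩
  have := (hderiv h x).const_add y₀
  rw [← funext hwh] at this
  simpa using this

/-! ### The equation `f'' = q f`: symmetries, Wronskians, uniqueness. -/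

/-- `f` and its derivative `g` solve the second-order equation `f'' = q f` at every point of `s`. -/
def IsSolOn (s : Set ℝ) (q f g : ℝ → ℂ) : Prop :=
  ∀ x ∈ s, HasDerivAt f (g x) x ∧ HasDerivAt g (q x * f x) x

namespace IsSolOn

variable {s t : Set ℝ} {q q₁ q₂ f g f₁ g₁ f₂ g₂ : ℝ → ℂ}

theorem mono (h : IsSolOn t q f g) (hst : s ⊆ t) : IsSolOn s q f g := fun x hx => h x (hst hx)

theorem congr_potential (h : IsSolOn s q₁ f g) (hq : ∀ x ∈ s, q₁ x = q₂ x) : IsSolOn s q₂ f g :=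
  fun x hx => ⟨(h x hx).1, hq x hx ▸ (h x hx).2⟩

theorem sub (h₁ : IsSolOn s q f₁ g₁) (h₂ : IsSolOn s q f₂ g₂) :
    IsSolOn s q (fun x => f₁ x - f₂ x) (fun x => g₁ x - g₂ x) := fun x hx =>
  ⟨(h₁ x hx).1.fun_sub (h₂ x hx).1, ((h₁ x hx).2.fun_sub (h₂ x hx).2).congr_deriv (by ring)⟩

theorem const_mul (c : ℂ) (h : IsSolOn s q f g) :
    IsSolOn s q (fun x => c * f x) (fun x => c * g x) := fun x hx =>
  ⟨(h x hx).1.const_mul c, ((h x hx).2.const_mul c).congr_deriv (by ring)⟩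

theorem comp_neg (h : IsSolOn Set.univ q f g) (hq : ∀ x, q (-x) = q x) :
    IsSolOn Set.univ q (fun x => f (-x)) (fun x => -g (-x)) := fun x _ => by
  have h1 := HasDerivAt.scomp x (h (-x) trivial).1 (hasDerivAt_neg x)
  have h2 := HasDerivAt.scomp x (h (-x) trivial).2 (hasDerivAt_neg x)
  refine ⟨h1.congr_deriv (by simp), h2.fun_neg.congr_deriv ?_⟩
  simp [hq]

theorem comp_add_one (h : IsSolOn s q f g) (hs : ∀ x ∈ s, x + 1 ∈ s)
    (hq : ∀ x ∈ s, q (x + 1) = q x) :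
    IsSolOn s q (fun x => f (x + 1)) (fun x => g (x + 1)) := fun x hx =>
  ⟨(h (x + 1) (hs x hx)).1.comp_add_const x 1,
    ((h (x + 1) (hs x hx)).2.comp_add_const x 1).congr_deriv (by rw [hq x hx])⟩

theorem conj (h : IsSolOn s q f g) :
    IsSolOn s (fun x => starRingEnd ℂ (q x)) (fun x => starRingEnd ℂ (f x))
      (fun x => starRingEnd ℂ (g x)) := fun x hx =>
  ⟨(h x hx).1.star, ((h x hx).2.star).congr_deriv (by simp)⟩

theorem continuous (h : IsSolOn Set.univ q f g) : Continuous f :=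
  continuous_iff_continuousAt.2 fun x => (h x trivial).1.continuousAt

theorem continuous_deriv (h : IsSolOn Set.univ q f g) : Continuous g :=
  continuous_iff_continuousAt.2 fun x => (h x trivial).2.continuousAt

theorem hasDerivAt_wronskian (h₁ : IsSolOn s q₁ f₁ g₁) (h₂ : IsSolOn s q₂ f₂ g₂) {x : ℝ}
    (hx : x ∈ s) :
    HasDerivAt (fun x => f₁ x * g₂ x - g₁ x * f₂ x) ((q₂ x - q₁ x) * (f₁ x * f₂ x)) x :=
  (((h₁ x hx).1.fun_mul (h₂ x hx).2).fun_sub ((h₁ x hx).2.fun_mul (h₂ x hx).1)).congr_deriv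
    (by ring)

/-- The Wronskian of two solutions of the same equation is constant. -/
theorem wronskian_eq [hs : s.OrdConnected] (h₁ : IsSolOn s q f₁ g₁) (h₂ : IsSolOn s q f₂ g₂)
    {x y : ℝ} (hx : x ∈ s) (hy : y ∈ s) :
    f₁ y * g₂ y - g₁ y * f₂ y = f₁ x * g₂ x - g₁ x * f₂ x := by
  have := intervalIntegral.integral_eq_sub_of_hasDerivAt (a := x) (b := y)
    (f := fun x => f₁ x * g₂ x - g₁ x * f₂ x) (f' := fun _ => 0)
    (fun z hz => (h₁.hasDerivAt_wronskian h₂ (hs.uIcc_subset hx hy hz)).congr_deriv (by ring))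
    intervalIntegrable_const
  simp only [intervalIntegral.integral_zero] at this
  exact (sub_eq_zero.1 this.symm)

/-- Green's identity for solutions with spectral parameters `z` and `w`. -/
theorem wronskian_sub_eq_integral {z : ℂ}
    (h₁ : IsSolOn Set.univ q₁ f₁ g₁) (h₂ : IsSolOn Set.univ q₂ f₂ g₂)
    (hq : ∀ x, q₂ x - q₁ x = z) (x y : ℝ) :
    (f₁ y * g₂ y - g₁ y * f₂ y) - (f₁ x * g₂ x - g₁ x * f₂ x) =
      z * ∫ t in x..y, f₁ t * f₂ t := by
  rw [← intervalIntegral.integral_const_mul]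
  refine (intervalIntegral.integral_eq_sub_of_hasDerivAt
    (f := fun x => f₁ x * g₂ x - g₁ x * f₂ x)
    (fun t _ => (h₁.hasDerivAt_wronskian h₂ trivial).congr_deriv (by rw [hq])) ?_).symm
  have := h₁.continuous
  have := h₂.continuous
  exact (by fun_prop : Continuous _).intervalIntegrable _ _

/-- Global existence for the initial value problem `f'' = q f`. -/
theorem exists_of_continuous (hq : Continuous q) (x₀ : ℝ) (a b : ℂ) :
    ∃ f g : ℝ → ℂ, IsSolOn Set.univ q f g ∧ f x₀ = a ∧ g x₀ = b := by
  let A : ℝ → ℂ × ℂ →L[ℝ] ℂ × ℂ := fun x =>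
    (ContinuousLinearMap.inl ℝ ℂ ℂ).comp (ContinuousLinearMap.snd ℝ ℂ ℂ) +
    (ContinuousLinearMap.inr ℝ ℂ ℂ).comp
      ((ContinuousLinearMap.mul ℝ ℂ (q x)).comp (ContinuousLinearMap.fst ℝ ℂ ℂ))
  have hA : Continuous A := by
    refine continuous_const.add (continuous_const.clm_comp
      (Continuous.clm_comp ?_ continuous_const))
    exact (ContinuousLinearMap.mul ℝ ℂ).continuous.comp hq
  obtain ⟨y, hy0, hy⟩ := exists_forall_hasDerivAt_linear hA x₀ (a, b)
  refine ⟨fun x => (y x).1, fun x => (y x).2, fun x _ => ⟨?_, ?_⟩, by simp [hy0], by simp [hy0]⟩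
  · exact ((ContinuousLinearMap.fst ℝ ℂ ℂ).hasFDerivAt.comp_hasDerivAt x (hy x)).congr_deriv
      (by simp [A])
  · exact ((ContinuousLinearMap.snd ℝ ℂ ℂ).hasFDerivAt.comp_hasDerivAt x (hy x)).congr_deriv
      (by simp [A])

/-- A solution with vanishing Cauchy data vanishes. -/
theorem eq_zero [s.OrdConnected] (hq : Continuous q) (h : IsSolOn s q f g) {x₀ x : ℝ}
    (hx₀ : x₀ ∈ s) (hx : x ∈ s) (hf : f x₀ = 0) (hg : g x₀ = 0) : f x = 0 ∧ g x = 0 := by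
  -- The fundamental solutions are normalized at `x`, so their Wronskians with `f` read off `g x`
  -- and `f x` there, while they vanish at `x₀`.
  obtain ⟨c, c', hc, hc0, hc1⟩ := exists_of_continuous hq x (1 : ℂ) 0
  obtain ⟨d, d', hd, hd0, hd1⟩ := exists_of_continuous hq x (0 : ℂ) 1
  have h1 := h.wronskian_eq (hc.mono (Set.subset_univ s)) hx₀ hx
  have h2 := h.wronskian_eq (hd.mono (Set.subset_univ s)) hx₀ hx
  simp only [hf, hg, hc0, hc1, hd0, hd1] at h1 h2
  exact ⟨by linear_combination h2, by linear_combination -h1⟩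

/-- Solutions are determined by their Cauchy data. -/
theorem unique [s.OrdConnected] (hq : Continuous q) (h₁ : IsSolOn s q f₁ g₁)
    (h₂ : IsSolOn s q f₂ g₂) {x₀ x : ℝ} (hx₀ : x₀ ∈ s) (hx : x ∈ s) (hf : f₁ x₀ = f₂ x₀)
    (hg : g₁ x₀ = g₂ x₀) : f₁ x = f₂ x ∧ g₁ x = g₂ x := by
  have := (h₁.sub h₂).eq_zero hq hx₀ hx (sub_eq_zero.2 hf) (sub_eq_zero.2 hg)
  exact ⟨sub_eq_zero.1 this.1, sub_eq_zero.1 this.2⟩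

/-- Pairing a solution with a test function `ψ` on a unit interval bounds the boundary terms by the
`L¹` norm of the solution. -/
theorem norm_green_le {Q : ℝ} (hq : Continuous q) (h : IsSolOn Set.univ q f g) {x : ℝ}
    (hQ : ∀ t ≥ x, ‖q t‖ ≤ Q) {ψ ψ' ψ'' : ℝ → ℝ} (h1 : ∀ t, HasDerivAt ψ (ψ' t) t)
    (h2 : ∀ t, HasDerivAt ψ' (ψ'' t) t) (hψ'' : Continuous ψ'')
    (b0 : ∀ t ∈ Set.Icc x (x + 1), |ψ t| ≤ 1) (b2 : ∀ t ∈ Set.Icc x (x + 1), |ψ'' t| ≤ 6) :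
    ‖(ψ (x + 1) * g (x + 1) - ψ' (x + 1) * f (x + 1)) - (ψ x * g x - ψ' x * f x)‖ ≤
      (Q + 6) * ∫ t in x..x + 1, ‖f t‖ := by
  have hf := h.continuous
  have hψ : Continuous ψ := continuous_iff_continuousAt.2 fun t => (h1 t).continuousAt
  have hd : ∀ t ∈ Set.uIcc x (x + 1), HasDerivAt (fun t => (ψ t : ℂ) * g t - ψ' t * f t)
      ((ψ t * q t - ψ'' t) * f t) t := fun t _ =>
    (((h1 t).ofReal_comp.fun_mul (h t trivial).2).fun_sub
      ((h2 t).ofReal_comp.fun_mul (h t trivial).1)).congr_deriv (by ring)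
  rw [← intervalIntegral.integral_eq_sub_of_hasDerivAt hd
    ((by fun_prop : Continuous _).intervalIntegrable _ _), ← intervalIntegral.integral_const_mul]
  refine intervalIntegral.norm_integral_le_of_norm_le (by linarith)
    (Filter.Eventually.of_forall fun t ht => ?_)
    ((by fun_prop : Continuous _).intervalIntegrable _ _)
  have ht' : t ∈ Set.Icc x (x + 1) := Set.Ioc_subset_Icc_self ht
  rw [norm_mul]
  gcongr
  calc ‖(ψ t : ℂ) * q t - ψ'' t‖ ≤ |ψ t| * ‖q t‖ + |ψ'' t| := by
        refine (norm_sub_le _ _).trans (le_of_eq ?_)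
        simp
    _ ≤ 1 * Q + 6 := by
        have := b0 t ht'
        have := b2 t ht'
        have := hQ t ht'.1
        gcongr
    _ = Q + 6 := by ring

end IsSolOn

/-! ### Decay of square-integrable solutions. -/

theorem tendsto_integral_unit_interval_norm {f : ℝ → ℂ} (hc : Continuous f)
    (hf : MeasureTheory.MemLp f 2 MeasureTheory.volume) :
    Filter.Tendsto (fun x => ∫ t in x..x + 1, ‖f t‖) Filter.atTop (nhds 0) := by
  have hi : MeasureTheory.Integrable (fun x => ‖f x‖ ^ 2) MeasureTheory.volume :=
    (MeasureTheory.memLp_two_iff_integrable_sq_norm hf.1).1 hf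
  have hI : ∀ a b, IntervalIntegrable (fun x => ‖f x‖ ^ 2) MeasureTheory.volume a b := fun a b =>
    (by fun_prop : Continuous _).intervalIntegrable _ _
  have hF := MeasureTheory.intervalIntegral_tendsto_integral_Ioi (0 : ℝ) hi.integrableOn
    Filter.tendsto_id
  have hF1 := hF.comp (Filter.tendsto_atTop_add_const_right Filter.atTop (1 : ℝ) Filter.tendsto_id)
  have hsq : Filter.Tendsto (fun x => ∫ t in x..x + 1, ‖f t‖ ^ 2) Filter.atTop (nhds 0) := by
    have := hF1.sub hF
    rw [sub_self] at this
    refine this.congr fun x => ?_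
    exact intervalIntegral.integral_interval_sub_left (hI _ _) (hI _ _)
  refine squeeze_zero (g := fun x => √(∫ t in x..x + 1, ‖f t‖ ^ 2))
    (fun x => intervalIntegral.integral_nonneg (by linarith) fun t _ => norm_nonneg _)
    (fun x => ?_) (by simpa using hsq.sqrt)
  have hnn : 0 ≤ ∫ t in x..x + 1, ‖f t‖ :=
    intervalIntegral.integral_nonneg (by linarith) fun t _ => norm_nonneg _
  refine Real.le_sqrt_of_sq_le ?_
  set m := ∫ t in x..x + 1, ‖f t‖
  -- Cauchy–Schwarz on a unit interval, in the form that a variance is nonnegative.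
  have : 0 ≤ ∫ t in x..x + 1, (‖f t‖ - m) ^ 2 :=
    intervalIntegral.integral_nonneg (by linarith) fun t _ => sq_nonneg _
  have e : ∫ t in x..x + 1, (‖f t‖ - m) ^ 2 = (∫ t in x..x + 1, ‖f t‖ ^ 2) - m ^ 2 := by
    have : (fun t => (‖f t‖ - m) ^ 2) = fun t => ‖f t‖ ^ 2 - (2 * m * ‖f t‖ - m ^ 2) := by
      funext t; ring
    rw [this, intervalIntegral.integral_sub (hI _ _)
      ((by fun_prop : Continuous _).intervalIntegrable _ _), intervalIntegral.integral_sub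
      ((by fun_prop : Continuous _).intervalIntegrable _ _) intervalIntegrable_const,
      intervalIntegral.integral_const_mul]
    simp only [intervalIntegral.integral_const, add_sub_cancel_left, one_smul]
    ring
  linarith

/-- Square-integrable solutions of an equation with bounded potential decay at infinity together
with their derivative. -/
theorem IsSolOn.tendsto_zero_of_memLp_two {q f g : ℝ → ℂ} (hq : Continuous q)
    (h : IsSolOn Set.univ q f g) {Q : ℝ} (hQ : ∀ t ≥ 0, ‖q t‖ ≤ Q)
    (hf : MeasureTheory.MemLp f 2 MeasureTheory.volume) :
    Filter.Tendsto f Filter.atTop (nhds 0) ∧ Filter.Tendsto g Filter.atTop (nhds 0) := by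
  have hlim : Filter.Tendsto (fun x => (Q + 6) * ∫ t in x..x + 1, ‖f t‖) Filter.atTop (nhds 0) := by
    simpa using (tendsto_integral_unit_interval_norm h.continuous hf).const_mul (Q + 6)
  constructor
  · refine squeeze_zero_norm' ?_ hlim
    filter_upwards [Filter.eventually_ge_atTop 0] with x hx
    -- With `s = t - x`, the Hermite cubic `s (1 - s)²` has value `0` and slope `1` at `x` and
    -- vanishes to second order at `x + 1`: the boundary terms reduce to `f x`.
    have := h.norm_green_le hq (fun t ht => hQ t (hx.trans ht))
      (ψ := fun t => (t - x) - 2 * (t - x) ^ 2 + (t - x) ^ 3)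
      (ψ' := fun t => 1 - 4 * (t - x) + 3 * (t - x) ^ 2) (ψ'' := fun t => -4 + 6 * (t - x))
      (fun t => by
        have h := (hasDerivAt_id' t).sub_const x
        exact ((h.fun_sub ((h.fun_pow 2).const_mul 2)).fun_add (h.fun_pow 3)).congr_deriv
          (by push_cast; ring))
      (fun t => by
        have h := (hasDerivAt_id' t).sub_const x
        exact (((hasDerivAt_const t (1 : ℝ)).fun_sub (h.const_mul 4)).fun_add
          ((h.fun_pow 2).const_mul 3)).congr_deriv (by push_cast; ring))
      (by fun_prop)
      (fun t ht => by
        obtain ⟨h0, h1⟩ : 0 ≤ t - x ∧ t - x ≤ 1 := ⟨by linarith [ht.1], by linarith [ht.2]⟩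
        rw [show (t - x) - 2 * (t - x) ^ 2 + (t - x) ^ 3 = (t - x) * (1 - (t - x)) ^ 2 by ring,
          abs_of_nonneg (by positivity)]
        exact mul_le_one₀ h1 (by positivity) (pow_le_one₀ (by linarith) (by linarith)))
      (fun t ht => by
        rw [abs_le]
        exact ⟨by linarith [ht.1], by linarith [ht.2]⟩)
    refine le_trans (le_of_eq ?_) this
    norm_num
  · refine squeeze_zero_norm' ?_ hlim
    filter_upwards [Filter.eventually_ge_atTop 0] with x hx
    -- The other Hermite cubic, with value `1` and slope `0` at `x`, isolates `g x` up to sign.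
    have := h.norm_green_le hq (fun t ht => hQ t (hx.trans ht))
      (ψ := fun t => 1 - 3 * (t - x) ^ 2 + 2 * (t - x) ^ 3)
      (ψ' := fun t => -6 * (t - x) + 6 * (t - x) ^ 2) (ψ'' := fun t => -6 + 12 * (t - x))
      (fun t => by
        have h := (hasDerivAt_id' t).sub_const x
        exact (((hasDerivAt_const t (1 : ℝ)).fun_sub ((h.fun_pow 2).const_mul 3)).fun_add
          ((h.fun_pow 3).const_mul 2)).congr_deriv (by push_cast; ring))
      (fun t => by
        have h := (hasDerivAt_id' t).sub_const x
        exact ((h.const_mul (-6)).fun_add ((h.fun_pow 2).const_mul 6)).congr_deriv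
          (by push_cast; ring))
      (by fun_prop)
      (fun t ht => by
        obtain ⟨h0, h1⟩ : 0 ≤ t - x ∧ t - x ≤ 1 := ⟨by linarith [ht.1], by linarith [ht.2]⟩
        rw [abs_le]
        constructor
        · nlinarith [mul_nonneg h0 (sq_nonneg (1 - (t - x))), sq_nonneg (1 - (t - x))]
        · nlinarith [mul_nonneg (sq_nonneg (t - x)) (sub_nonneg.2 h1), sq_nonneg (t - x)])
      (fun t ht => by
        rw [abs_le]
        exact ⟨by linarith [ht.1], by linarith [ht.2]⟩)
    refine le_trans (le_of_eq ?_) this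
    norm_num

/-! ### Cauchy estimates and Newton's method. -/

/-- Second-order Cauchy estimate: a holomorphic function that varies by at most `K` on a ball of
radius `R` has a derivative that varies by at most `8 K / R² * ‖z - c‖`. -/
theorem norm_deriv_sub_deriv_le_of_norm_sub_le {f : ℂ → ℂ} {c : ℂ} {R K : ℝ} (hR : 0 < R)
    (hd : DifferentiableOn ℂ f (Metric.ball c R)) (hK : ∀ z ∈ Metric.ball c R, ‖f z - f c‖ ≤ K)
    {z : ℂ} (hz : z ∈ Metric.ball c (R / 4)) :
    ‖deriv f z - deriv f c‖ ≤ 8 * K / R ^ 2 * ‖z - c‖ := by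
  have hsub : ∀ {a b : ℝ} {w : ℂ}, w ∈ Metric.ball c a → a + b ≤ R →
      Metric.closedBall w b ⊆ Metric.ball c R := fun {a b w} hw hab => by
    refine Metric.closedBall_subset_ball' ?_
    linarith [Metric.mem_ball.1 hw]
  have h1 : ∀ w ∈ Metric.ball c (R / 2), ‖deriv f w‖ ≤ 2 * K / R := fun w hw => by
    have hs := hsub hw (b := R / 2) (by linarith)
    have := Complex.norm_deriv_le_of_forall_mem_sphere_norm_le (f := fun z => f z - f c)
      (half_pos hR)
      (DifferentiableOn.diffContOnCl_ball ((hd.mono hs).sub_const _) subset_rfl)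
      (fun z hz => hK z (hs (Metric.sphere_subset_closedBall hz)))
    rw [deriv_sub_const_fun] at this
    exact this.trans (le_of_eq (by field_simp))
  have hd' : DifferentiableOn ℂ (deriv f) (Metric.ball c R) := hd.deriv Metric.isOpen_ball
  have h2 : ∀ w ∈ Metric.ball c (R / 4), ‖deriv (deriv f) w‖ ≤ 8 * K / R ^ 2 := fun w hw => by
    have hs := hsub hw (b := R / 4) (by linarith)
    have := Complex.norm_deriv_le_of_forall_mem_sphere_norm_le (f := deriv f)
      (by positivity : 0 < R / 4)
      (DifferentiableOn.diffContOnCl_ball (hd'.mono hs) subset_rfl)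
      (fun z hz => h1 z (by
        refine Metric.mem_ball.2 ((dist_triangle z w c).trans_lt ?_)
        linarith [Metric.mem_sphere.1 hz, Metric.mem_ball.1 hw]))
    exact this.trans (le_of_eq (by field_simp; ring))
  refine (convex_ball c (R / 4)).norm_image_sub_le_of_norm_deriv_le (fun w hw => ?_) h2
    (Metric.mem_ball_self (by positivity)) hz
  exact hd'.differentiableAt
    (Metric.isOpen_ball.mem_nhds (Metric.ball_subset_ball (by linarith) hw))

/-- Quantitative simplified Newton method: location of the unique root of a holomorphic function
near a point where the function is small compared with its derivative. -/
theorem hasUniqueRootNear_of_norm_sub_le {f : ℂ → ℂ} {E R K r η : ℝ} (hR : 0 < R)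
    (hd : DifferentiableOn ℂ f (Metric.ball (E : ℂ) R))
    (hK : ∀ z ∈ Metric.ball (E : ℂ) R, ‖f z - f E‖ ≤ K) (h' : deriv f (E : ℂ) ≠ 0) (hr : 0 < r)
    (hrR : r < R / 4) (hη : 8 * K / R ^ 2 ≤ η * ‖deriv f (E : ℂ)‖) (hηr : η * r ≤ 1 / 2)
    (hA : ‖f E / deriv f (E : ℂ)‖ ≤ r / 2) :
    HasUniqueRootNear f E r (4 * η * ‖f E / deriv f (E : ℂ)‖ ^ 2) := by
  set D := deriv f (E : ℂ) with hD
  have hDpos : 0 < ‖D‖ := norm_pos_iff.2 h'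
  have hK0 : 0 ≤ K := (norm_nonneg _).trans (hK E (Metric.mem_ball_self hR))
  have hη0 : 0 ≤ η := by
    by_contra hneg
    have : η * ‖D‖ < 0 := mul_neg_of_neg_of_pos (not_le.1 hneg) hDpos
    have : 0 ≤ 8 * K / R ^ 2 := by positivity
    linarith
  -- Newton's map with the derivative frozen at `E`. Its derivative `1 - f'/D` vanishes at `E` and
  -- is at most `η |z - E|`, so on the ball of radius `t` it is Lipschitz with constant `η t`.
  set F : ℂ → ℂ := fun z => z - f z / D with hF
  have hlip : ∀ t ≤ r, ∀ z ∈ Metric.closedBall (E : ℂ) t, ∀ w ∈ Metric.closedBall (E : ℂ) t,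
      ‖F z - F w‖ ≤ η * t * ‖z - w‖ := fun t ht z hz w hw => by
    have hin : ∀ y ∈ Metric.closedBall (E : ℂ) t, y ∈ Metric.ball (E : ℂ) (R / 4) := fun y hy =>
      Metric.closedBall_subset_ball (by linarith) hy
    have hder : ∀ y ∈ Metric.closedBall (E : ℂ) t, HasDerivAt F (1 - deriv f y / D) y :=
      fun y hy => (hasDerivAt_id' y).fun_sub ((hd.differentiableAt (Metric.isOpen_ball.mem_nhds
        (Metric.ball_subset_ball (by linarith) (hin y hy)))).hasDerivAt.div_const D)
    refine (convex_closedBall (E : ℂ) t).norm_image_sub_le_of_norm_hasDerivWithin_le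
      (fun y hy => (hder y hy).hasDerivWithinAt) (fun y hy => ?_) hw hz
    have e : 1 - deriv f y / D = -(deriv f y - D) / D := by field_simp; ring
    rw [e, norm_div, norm_neg, div_le_iff₀ hDpos]
    calc ‖deriv f y - D‖ ≤ 8 * K / R ^ 2 * ‖y - E‖ :=
          norm_deriv_sub_deriv_le_of_norm_sub_le hR hd hK (hin y hy)
      _ ≤ η * ‖D‖ * t := by
          have : ‖y - E‖ ≤ t := mem_closedBall_iff_norm.1 hy
          gcongr
      _ = η * t * ‖D‖ := by ring
  have hlip' : ∀ z ∈ Metric.closedBall (E : ℂ) r, ∀ w ∈ Metric.closedBall (E : ℂ) r,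
      ‖F z - F w‖ ≤ 1 / 2 * ‖z - w‖ := fun z hz w hw =>
    (hlip r le_rfl z hz w hw).trans (by gcongr)
  have hEr : (E : ℂ) ∈ Metric.closedBall (E : ℂ) r := Metric.mem_closedBall_self hr.le
  have hFE : F E - E = -(f E / D) := by simp [hF]
  have hmaps : Set.MapsTo F (Metric.closedBall (E : ℂ) r) (Metric.closedBall (E : ℂ) r) :=
    fun z hz => by
      rw [mem_closedBall_iff_norm] at hz ⊢
      calc ‖F z - E‖ = ‖(F z - F E) + (F E - E)‖ := by ring_nf
        _ ≤ ‖F z - F E‖ + ‖F E - E‖ := norm_add_le _ _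
        _ ≤ 1 / 2 * ‖z - E‖ + r / 2 := by
            refine add_le_add (hlip' z (mem_closedBall_iff_norm.2 hz) E hEr) ?_
            rwa [hFE, norm_neg]
        _ ≤ r := by linarith
  have hcontr : ContractingWith (1 / 2) (hmaps.restrict F _ _) := by
    refine ⟨by norm_num, LipschitzWith.of_dist_le_mul fun z w => ?_⟩
    simpa [Subtype.dist_eq, dist_eq_norm] using hlip' z z.2 w w.2
  have hroot : ∀ z, F z = z ↔ f z = 0 := fun z => by simp [hF, h']
  obtain ⟨zs, hzs, hfix, -⟩ := hcontr.exists_fixedPoint' Metric.isClosed_closedBall.isComplete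
    hmaps hEr (edist_ne_top _ _)
  have hfix : F zs = zs := hfix
  have hnear : ‖zs - E‖ ≤ 2 * ‖f E / D‖ := by
    have : ‖zs - E‖ ≤ 1 / 2 * ‖zs - E‖ + ‖f E / D‖ :=
      calc ‖zs - E‖ = ‖(F zs - F E) + (F E - E)‖ := by rw [hfix]; ring_nf
        _ ≤ ‖F zs - F E‖ + ‖F E - E‖ := norm_add_le _ _
        _ ≤ 1 / 2 * ‖zs - E‖ + ‖f E / D‖ := by
            refine add_le_add (hlip' zs hzs E hEr) ?_
            rw [hFE, norm_neg]
    linarith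
  refine ⟨h', zs, mem_closedBall_iff_norm.1 hzs, (hroot zs).1 hfix, fun w hw hw0 => ?_, ?_⟩
  · have := hlip' w (mem_closedBall_iff_norm.2 hw) zs hzs
    rw [(hroot w).2 hw0, hfix] at this
    have h0 : ‖w - zs‖ ≤ 0 := by linarith [norm_nonneg (w - zs)]
    exact sub_eq_zero.1 (norm_le_zero_iff.1 h0)
  · set A := ‖f E / D‖ with hAdef
    have hA0 : 0 ≤ A := norm_nonneg _
    -- The root is already known to lie within `2A` of `E`; using the Lipschitz constant of that
    -- smaller ball instead of `r` makes the error quadratic in `A`.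
    have := hlip (2 * A) (by linarith) zs (mem_closedBall_iff_norm.2 hnear) E
      (Metric.mem_closedBall_self (by positivity))
    rw [hfix] at this
    refine this.trans ?_
    calc η * (2 * A) * ‖zs - E‖ ≤ η * (2 * A) * (2 * A) := by gcongr
      _ = 4 * η * A ^ 2 := by ring

/-! ### Dependence of solutions on the spectral parameter. -/

/-- `U z`, with derivative `G z`, is for each `z` the solution of `u'' = (q - z) u` with Cauchy data
`(a, b)` at the origin. -/
structure IsSolFamily (q : ℝ → ℂ) (a b : ℂ) (U G : ℂ → ℝ → ℂ) : Prop where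
  sol : ∀ z, IsSolOn Set.univ (fun x => q x - z) (U z) (G z)
  apply_zero : ∀ z, U z 0 = a
  deriv_zero : ∀ z, G z 0 = b

theorem exists_isSolFamily {q : ℝ → ℂ} (hq : Continuous q) (a b : ℂ) :
    ∃ U G, IsSolFamily q a b U G := by
  have h : ∀ z : ℂ, ∃ f g : ℝ → ℂ, IsSolOn Set.univ (fun x => q x - z) f g ∧ f 0 = a ∧ g 0 = b :=
    fun z => IsSolOn.exists_of_continuous (hq.sub continuous_const) 0 a b
  choose U G hUG using h
  exact ⟨U, G, fun z => (hUG z).1, fun z => (hUG z).2.1, fun z => (hUG z).2.2⟩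

namespace IsSolFamily

variable {q : ℝ → ℂ} {a b : ℂ} {U G : ℂ → ℝ → ℂ}

theorem conj_apply (h : IsSolFamily q a b U G) (hq : Continuous q)
    (hqr : ∀ x, starRingEnd ℂ (q x) = q x) (ha : starRingEnd ℂ a = a) (hb : starRingEnd ℂ b = b)
    (z : ℂ) (x : ℝ) :
    starRingEnd ℂ (U z x) = U (starRingEnd ℂ z) x ∧
      starRingEnd ℂ (G z x) = G (starRingEnd ℂ z) x := by
  have h1 := (h.sol z).conj
  simp only [map_sub, hqr] at h1
  refine h1.unique (hq.sub continuous_const) (h.sol (starRingEnd ℂ z)) (Set.mem_univ 0)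
    (Set.mem_univ x) ?_ ?_
  · simp only [h.apply_zero, ha]
  · simp only [h.deriv_zero, hb]

variable {z₀ : ℂ} {p p' r r' : ℝ → ℂ}

/-- Variation of constants in the spectral parameter. -/
theorem sub_eq (h : IsSolFamily q a b U G) (hp : IsSolOn Set.univ (fun x => q x - z₀) p p')
    (hr : IsSolOn Set.univ (fun x => q x - z₀) r r') (hW : p 0 * r' 0 - p' 0 * r 0 = 1)
    (z : ℂ) (x : ℝ) :
    U z x - U z₀ x =
        (z - z₀) * (p x * (∫ t in (0 : ℝ)..x, U z t * r t) - r x * ∫ t in (0 : ℝ)..x, U z t * p t) ∧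
      G z x - G z₀ x =
        (z - z₀) *
          (p' x * (∫ t in (0 : ℝ)..x, U z t * r t) - r' x * ∫ t in (0 : ℝ)..x, U z t * p t) := by
  have hWx : p x * r' x - p' x * r x = 1 :=
    (hp.wronskian_eq hr (Set.mem_univ 0) (Set.mem_univ x)).trans hW
  -- Taking `s = p` and `s = r` gives two linear equations for the differences of `U` and `G`; their
  -- determinant is the Wronskian of `p` and `r`, equal to `1`.
  have key : ∀ {s s' : ℝ → ℂ}, IsSolOn Set.univ (fun x => q x - z₀) s s' →
      (U z x - U z₀ x) * s' x - (G z x - G z₀ x) * s x =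
        (z - z₀) * ∫ t in (0 : ℝ)..x, U z t * s t := fun {s s'} hs => by
    have h1 := (h.sol z).wronskian_sub_eq_integral hs (z := z - z₀) (fun x => by ring) 0 x
    have h2 := (h.sol z₀).wronskian_eq hs (Set.mem_univ 0) (Set.mem_univ x)
    simp only [h.apply_zero, h.deriv_zero] at h1 h2
    linear_combination h1 - h2
  have h1 := key hp
  have h2 := key hr
  constructor
  · linear_combination p x * h2 - r x * h1 - (U z x - U z₀ x) * hWx
  · linear_combination p' x * h2 - r' x * h1 - (G z x - G z₀ x) * hWx

/-- Stability of the solution in the spectral parameter, in a space with weight `e^{κx}`, in the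
presence of an exponential dichotomy `p, r` for the unperturbed equation. -/
theorem norm_sub_le (h : IsSolFamily q a b U G)
    (hp : IsSolOn Set.univ (fun x => q x - z₀) p p')
    (hr : IsSolOn Set.univ (fun x => q x - z₀) r r') (hW : p 0 * r' 0 - p' 0 * r 0 = 1)
    {κ K K₁ X : ℝ} (hκ : 0 ≤ κ)
    (hpK : ∀ x ∈ Set.Icc 0 X, ‖p x‖ ≤ K * Real.exp (-κ * x) ∧ ‖p' x‖ ≤ K * Real.exp (-κ * x))
    (hrK : ∀ x ∈ Set.Icc 0 X, ‖r x‖ ≤ K * Real.exp (κ * x) ∧ ‖r' x‖ ≤ K * Real.exp (κ * x))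
    (hK₁ : ∀ x ∈ Set.Icc 0 X, ∫ t in (0 : ℝ)..x, ‖U z₀ t‖ * Real.exp (-κ * t) ≤ K₁)
    {z : ℂ} (hz : ‖z - z₀‖ * (2 * K ^ 2) * X ≤ 1 / 2) {x : ℝ} (hx : x ∈ Set.Icc 0 X) :
    ‖U z x - U z₀ x‖ ≤ 4 * K ^ 2 * K₁ * ‖z - z₀‖ * Real.exp (κ * x) ∧
      ‖G z x - G z₀ x‖ ≤ 4 * K ^ 2 * K₁ * ‖z - z₀‖ * Real.exp (κ * x) := by
  have hUc := (h.sol z).continuous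
  have hU0c := (h.sol z₀).continuous
  have hpc := hp.continuous
  have hrc := hr.continuous
  have hX : 0 ≤ X := hx.1.trans hx.2
  have h0 : (0 : ℝ) ∈ Set.Icc 0 X := ⟨le_rfl, hX⟩
  have hK0 : 0 ≤ K := by
    have := (norm_nonneg _).trans (hpK 0 h0).1
    simpa using this
  have hK₁0 : 0 ≤ K₁ := by simpa using hK₁ 0 h0
  set J : ℝ → ℝ := fun x => ∫ t in (0 : ℝ)..x, ‖U z t‖ * Real.exp (-κ * t) with hJ
  have hintp : ∀ y ∈ Set.Icc 0 X, ‖∫ t in (0 : ℝ)..y, U z t * p t‖ ≤ K * J y := fun y hy => by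
    rw [hJ, ← intervalIntegral.integral_const_mul]
    refine intervalIntegral.norm_integral_le_of_norm_le hy.1
      (Filter.Eventually.of_forall fun t ht => ?_)
      ((by fun_prop : Continuous _).intervalIntegrable _ _)
    rw [norm_mul]
    calc ‖U z t‖ * ‖p t‖ ≤ ‖U z t‖ * (K * Real.exp (-κ * t)) := by
          gcongr
          exact (hpK t ⟨ht.1.le, ht.2.trans hy.2⟩).1
      _ = K * (‖U z t‖ * Real.exp (-κ * t)) := by ring
  have hintr : ∀ y ∈ Set.Icc 0 X,
      ‖∫ t in (0 : ℝ)..y, U z t * r t‖ ≤ K * Real.exp (2 * κ * y) * J y := fun y hy => by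
    rw [hJ, ← intervalIntegral.integral_const_mul]
    refine intervalIntegral.norm_integral_le_of_norm_le hy.1
      (Filter.Eventually.of_forall fun t ht => ?_)
      ((by fun_prop : Continuous _).intervalIntegrable _ _)
    rw [norm_mul]
    calc ‖U z t‖ * ‖r t‖ ≤ ‖U z t‖ * (K * Real.exp (κ * t)) := by
          gcongr
          exact (hrK t ⟨ht.1.le, ht.2.trans hy.2⟩).1
      _ ≤ ‖U z t‖ * (K * (Real.exp (2 * κ * y) * Real.exp (-κ * t))) := by
          rw [← Real.exp_add]
          have := mul_le_mul_of_nonneg_left ht.2 hκ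
          gcongr
          linarith
      _ = K * Real.exp (2 * κ * y) * (‖U z t‖ * Real.exp (-κ * t)) := by ring
  have hstep : ∀ y ∈ Set.Icc 0 X,
      ‖U z y - U z₀ y‖ ≤ ‖z - z₀‖ * (2 * K ^ 2) * Real.exp (κ * y) * J y ∧
      ‖G z y - G z₀ y‖ ≤ ‖z - z₀‖ * (2 * K ^ 2) * Real.exp (κ * y) * J y := fun y hy => by
    have aux : ∀ α β : ℂ, ‖α‖ ≤ K * Real.exp (-κ * y) → ‖β‖ ≤ K * Real.exp (κ * y) →
        ‖(z - z₀) * (α * (∫ t in (0 : ℝ)..y, U z t * r t) - β * ∫ t in (0 : ℝ)..y, U z t * p t)‖ ≤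
          ‖z - z₀‖ * (2 * K ^ 2) * Real.exp (κ * y) * J y := fun α β hα hβ => by
      rw [norm_mul]
      calc _ ≤ ‖z - z₀‖ * (K * Real.exp (-κ * y) * (K * Real.exp (2 * κ * y) * J y) +
            K * Real.exp (κ * y) * (K * J y)) := by
            gcongr
            refine (_root_.norm_sub_le _ _).trans ?_
            rw [norm_mul, norm_mul]
            have h1 := hintr y hy
            have h2 := hintp y hy
            gcongr
        _ = ‖z - z₀‖ * (2 * K ^ 2) * Real.exp (κ * y) * J y := by
            rw [show Real.exp (2 * κ * y) = Real.exp (κ * y) * Real.exp (κ * y) by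
              rw [← Real.exp_add]; ring_nf, neg_mul, Real.exp_neg]
            field_simp
            ring
    rw [(h.sub_eq hp hr hW z y).1, (h.sub_eq hp hr hW z y).2]
    exact ⟨aux _ _ (hpK y hy).1 (hrK y hy).1, aux _ _ (hpK y hy).2 (hrK y hy).2⟩
  -- Absorption: the maximum `D` of the weighted difference exists by compactness and satisfies `D ≤
  -- ‖z - z₀‖ * (2 * K ^ 2) * (K₁ + X * D)`. The smallness of `‖z - z₀‖ * X` then gives `X * D ≤
  -- K₁`, without the exponential loss of Gronwall's inequality.
  have hJle : ∀ y ∈ Set.Icc 0 X, J y ≤ 2 * K₁ := by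
    obtain ⟨m, hm, hmax⟩ := isCompact_Icc.exists_isMaxOn ⟨0, h0⟩
      ((by fun_prop : Continuous fun x => ‖U z x - U z₀ x‖ * Real.exp (-κ * x)).continuousOn
        (s := Set.Icc 0 X))
    set D := ‖U z m - U z₀ m‖ * Real.exp (-κ * m) with hD
    have hD0 : 0 ≤ D := by positivity
    have hJD : ∀ y ∈ Set.Icc 0 X, J y ≤ K₁ + X * D := fun y hy => by
      calc J y ≤ ∫ t in (0 : ℝ)..y, (‖U z₀ t‖ * Real.exp (-κ * t) + D) := by
            refine intervalIntegral.integral_mono_on hy.1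
              ((by fun_prop : Continuous _).intervalIntegrable _ _)
              ((by fun_prop : Continuous _).intervalIntegrable _ _) fun t ht => ?_
            have h1 : ‖U z t - U z₀ t‖ * Real.exp (-κ * t) ≤ D :=
              hmax (⟨ht.1, ht.2.trans hy.2⟩ : t ∈ Set.Icc 0 X)
            have h2 : ‖U z t‖ ≤ ‖U z₀ t‖ + ‖U z t - U z₀ t‖ := norm_le_norm_add_norm_sub' _ _
            have := mul_le_mul_of_nonneg_right h2 (Real.exp_pos (-κ * t)).le
            linarith
        _ = (∫ t in (0 : ℝ)..y, ‖U z₀ t‖ * Real.exp (-κ * t)) + y * D := by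
            rw [intervalIntegral.integral_add
              ((by fun_prop : Continuous _).intervalIntegrable _ _) intervalIntegrable_const]
            simp
        _ ≤ K₁ + X * D := by
            have := hK₁ y hy
            have := hy.2
            gcongr
    have hDle : D ≤ ‖z - z₀‖ * (2 * K ^ 2) * (K₁ + X * D) := by
      calc D ≤ ‖z - z₀‖ * (2 * K ^ 2) * Real.exp (κ * m) * J m * Real.exp (-κ * m) := by
            rw [hD]
            gcongr
            exact (hstep m hm).1
        _ = ‖z - z₀‖ * (2 * K ^ 2) * J m := by
            rw [neg_mul, Real.exp_neg]
            field_simp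
        _ ≤ _ := by
            gcongr
            exact hJD m hm
    have hXD : X * D ≤ K₁ := by
      have h1 := mul_le_mul_of_nonneg_left hDle hX
      have h2 : X * (‖z - z₀‖ * (2 * K ^ 2) * (K₁ + X * D)) ≤ 1 / 2 * (K₁ + X * D) := by
        calc _ = ‖z - z₀‖ * (2 * K ^ 2) * X * (K₁ + X * D) := by ring
          _ ≤ _ := by gcongr
      linarith
    exact fun y hy => (hJD y hy).trans (by linarith)
  have hfin : ‖z - z₀‖ * (2 * K ^ 2) * Real.exp (κ * x) * J x ≤
      4 * K ^ 2 * K₁ * ‖z - z₀‖ * Real.exp (κ * x) := by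
    calc _ ≤ ‖z - z₀‖ * (2 * K ^ 2) * Real.exp (κ * x) * (2 * K₁) := by
          gcongr
          exact hJle x hx
      _ = _ := by ring
  exact ⟨(hstep x hx).1.trans hfin, (hstep x hx).2.trans hfin⟩

/-- Local Lipschitz continuity in the spectral parameter, uniformly on compact intervals. -/
theorem exists_norm_sub_le (h : IsSolFamily q a b U G)
    (hp : IsSolOn Set.univ (fun x => q x - z₀) p p')
    (hr : IsSolOn Set.univ (fun x => q x - z₀) r r') (hW : p 0 * r' 0 - p' 0 * r 0 = 1)
    {X : ℝ} (hX : 0 ≤ X) :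
    ∃ C : ℝ, ∀ᶠ z in nhds z₀, ∀ x ∈ Set.Icc 0 X, ‖U z x - U z₀ x‖ ≤ C * ‖z - z₀‖ := by
  have bdd : ∀ f : ℝ → ℂ, Continuous f → ∃ K, ∀ x ∈ Set.Icc 0 X, ‖f x‖ ≤ K := fun f hf =>
    isCompact_Icc.exists_bound_of_continuousOn hf.continuousOn
  obtain ⟨K₁, hK₁⟩ := bdd p hp.continuous
  obtain ⟨K₂, hK₂⟩ := bdd p' hp.continuous_deriv
  obtain ⟨K₃, hK₃⟩ := bdd r hr.continuous
  obtain ⟨K₄, hK₄⟩ := bdd r' hr.continuous_deriv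
  obtain ⟨K₅, hK₅⟩ := bdd (U z₀) (h.sol z₀).continuous
  set K := max (max K₁ K₂) (max K₃ K₄) with hK
  have hev : ∀ᶠ z in nhds z₀, ‖z - z₀‖ * (2 * K ^ 2) * X ≤ 1 / 2 := by
    have : Filter.Tendsto (fun z => ‖z - z₀‖ * (2 * K ^ 2) * X) (nhds z₀) (nhds 0) := by
      have hc : Continuous fun z : ℂ => ‖z - z₀‖ * (2 * K ^ 2) * X := by fun_prop
      simpa using hc.tendsto z₀
    exact (this.eventually_lt_const (by norm_num)).mono fun z hz => le_of_lt hz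
  refine ⟨4 * K ^ 2 * (X * K₅), hev.mono fun z hz x hx => ?_⟩
  -- On a compact interval plain bounds suffice, so the weight is trivial.
  have := h.norm_sub_le hp hr hW (κ := 0) (K := K) (K₁ := X * K₅) le_rfl
    (fun x hx => by
      simp only [neg_zero, zero_mul, Real.exp_zero, mul_one]
      exact ⟨(hK₁ x hx).trans (by simp [hK]), (hK₂ x hx).trans (by simp [hK])⟩)
    (fun x hx => by
      simp only [zero_mul, Real.exp_zero, mul_one]
      exact ⟨(hK₃ x hx).trans (by simp [hK]), (hK₄ x hx).trans (by simp [hK])⟩)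
    (fun x hx => by
      simp only [neg_zero, zero_mul, Real.exp_zero, mul_one]
      have hK50 := (norm_nonneg _).trans (hK₅ 0 ⟨le_rfl, hX⟩)
      have hUc := (h.sol z₀).continuous
      calc ∫ t in (0 : ℝ)..x, ‖U z₀ t‖ ≤ ∫ t in (0 : ℝ)..x, K₅ :=
            intervalIntegral.integral_mono_on hx.1
              ((by fun_prop : Continuous _).intervalIntegrable _ _) intervalIntegrable_const
              fun t ht => hK₅ t ⟨ht.1, ht.2.trans hx.2⟩
        _ = x * K₅ := by simp
        _ ≤ X * K₅ := by
            have := hx.2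
            gcongr)
    hz hx
  simpa using this.1

/-- The solution and its derivative at a point are holomorphic in the spectral parameter. -/
theorem hasDerivAt_param (h : IsSolFamily q a b U G)
    (hp : IsSolOn Set.univ (fun x => q x - z₀) p p')
    (hr : IsSolOn Set.univ (fun x => q x - z₀) r r') (hW : p 0 * r' 0 - p' 0 * r 0 = 1)
    {X : ℝ} (hX : 0 ≤ X) :
    HasDerivAt (fun z => U z X) (p X * (∫ t in (0 : ℝ)..X, U z₀ t * r t) -
        r X * ∫ t in (0 : ℝ)..X, U z₀ t * p t) z₀ ∧
      HasDerivAt (fun z => G z X) (p' X * (∫ t in (0 : ℝ)..X, U z₀ t * r t) -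
        r' X * ∫ t in (0 : ℝ)..X, U z₀ t * p t) z₀ := by
  obtain ⟨C, hC⟩ := h.exists_norm_sub_le hp hr hW hX
  have hintegral : ∀ s : ℝ → ℂ, Continuous s → Filter.Tendsto (fun z => ∫ t in (0 : ℝ)..X, U z t * s t)
      (nhds z₀) (nhds (∫ t in (0 : ℝ)..X, U z₀ t * s t)) := fun s hs => by
    obtain ⟨S, hS⟩ := (isCompact_Icc (a := (0 : ℝ)) (b := X)).exists_bound_of_continuousOn
      hs.continuousOn
    rw [tendsto_iff_norm_sub_tendsto_zero]
    refine squeeze_zero' (Filter.Eventually.of_forall fun z => norm_nonneg _)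
      (g := fun z => C * ‖z - z₀‖ * S * |X - 0|) (hC.mono fun z hz => ?_) ?_
    · have hUz := (h.sol z).continuous
      have hUz₀ := (h.sol z₀).continuous
      rw [← intervalIntegral.integral_sub ((by fun_prop : Continuous _).intervalIntegrable _ _)
        ((by fun_prop : Continuous _).intervalIntegrable _ _)]
      refine intervalIntegral.norm_integral_le_of_norm_le_const fun t ht => ?_
      rw [Set.uIoc_of_le hX] at ht
      have ht' : t ∈ Set.Icc 0 X := Set.Ioc_subset_Icc_self ht
      rw [← sub_mul, norm_mul]
      have h1 := hz t ht'
      have h2 := hS t ht'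
      have h3 := (norm_nonneg _).trans h1
      gcongr
    · have hc : Continuous fun z : ℂ => C * ‖z - z₀‖ * S * |X - 0| := by fun_prop
      simpa using hc.tendsto z₀
  have aux : ∀ (F : ℂ → ℂ) (α β : ℂ),
      (∀ z, F z - F z₀ = (z - z₀) * (α * (∫ t in (0 : ℝ)..X, U z t * r t) -
        β * ∫ t in (0 : ℝ)..X, U z t * p t)) →
      HasDerivAt F (α * (∫ t in (0 : ℝ)..X, U z₀ t * r t) -
        β * ∫ t in (0 : ℝ)..X, U z₀ t * p t) z₀ := fun F α β hF => by
    rw [hasDerivAt_iff_tendsto_slope]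
    refine Filter.Tendsto.congr' ?_ ((((hintegral r hr.continuous).const_mul α).sub
      ((hintegral p hp.continuous).const_mul β)).mono_left nhdsWithin_le_nhds)
    filter_upwards [self_mem_nhdsWithin] with z hz
    have : z - z₀ ≠ 0 := sub_ne_zero.2 hz
    rw [slope_def_field, hF z]
    field_simp
  exact ⟨aux _ _ _ fun z => (h.sub_eq hp hr hW z X).1, aux _ _ _ fun z => (h.sub_eq hp hr hW z X).2⟩

theorem differentiable_param (h : IsSolFamily q a b U G) (hq : Continuous q) {X : ℝ} (hX : 0 ≤ X) :
    Differentiable ℂ (fun z => U z X) ∧ Differentiable ℂ (fun z => G z X) := by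
  have key : ∀ z₀ : ℂ, DifferentiableAt ℂ (fun z => U z X) z₀ ∧
      DifferentiableAt ℂ (fun z => G z X) z₀ := fun z₀ => by
    have hq₀ : Continuous fun x => q x - z₀ := hq.sub continuous_const
    obtain ⟨p, p', hp, hp0, hp1⟩ := IsSolOn.exists_of_continuous hq₀ 0 1 0
    obtain ⟨r, r', hr, hr0, hr1⟩ := IsSolOn.exists_of_continuous hq₀ 0 0 1
    have := h.hasDerivAt_param hp hr (by simp [hp0, hp1, hr0, hr1]) hX
    exact ⟨this.1.differentiableAt, this.2.differentiableAt⟩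
  exact ⟨fun z₀ => (key z₀).1, fun z₀ => (key z₀).2⟩

end IsSolFamily

/-! ### Floquet theory derived from a decaying solution. -/

theorem exists_bound_of_eventually_periodic {φ : ℝ → ℝ} (hc : Continuous φ) {N : ℝ} (hN : 0 ≤ N)
    (h : ∀ x ≥ N, φ (x + 1) = φ x) : ∃ K, ∀ x ≥ 0, |φ x| ≤ K := by
  obtain ⟨K, hK⟩ := (isCompact_Icc (a := (0 : ℝ)) (b := N + 1)).exists_bound_of_continuousOn
    hc.continuousOn
  have key : ∀ n : ℕ, ∀ x ∈ Set.Icc 0 (N + 1 + n), |φ x| ≤ K := fun n => by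
    induction n with
    | zero => simpa using hK
    | succ n ih =>
      intro x hx
      rcases le_total x (N + 1) with hx1 | hx1
      · exact hK x ⟨hx.1, hx1⟩
      · have h1 := h (x - 1) (by linarith)
        rw [sub_add_cancel] at h1
        rw [h1]
        have h2 := hx.2
        push_cast at h2
        exact ih (x - 1) ⟨by linarith, by linarith⟩
  refine ⟨K, fun x hx => ?_⟩
  obtain ⟨n, hn⟩ := exists_nat_ge x
  exact key n x ⟨hx, by linarith⟩

/-- A function multiplied by `c` under translation by one period is bounded by `|c|^x`. -/
theorem exists_norm_le_exp_of_multiplier {f : ℝ → ℂ} (hf : Continuous f) {N c : ℝ} (hN : 0 ≤ N)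
    (hc : c ≠ 0) (h : ∀ x ≥ N, f (x + 1) = c * f x) :
    ∃ K, ∀ x ≥ 0, ‖f x‖ ≤ K * Real.exp (Real.log |c| * x) := by
  obtain ⟨K, hK⟩ := exists_bound_of_eventually_periodic
    (φ := fun x => ‖f x‖ * Real.exp (-(Real.log |c| * x))) (by fun_prop) hN fun x hx => by
      rw [h x hx, norm_mul, mul_add, neg_add, Real.exp_add, mul_one, Real.exp_neg (Real.log |c|),
        Real.exp_log (abs_pos.2 hc), Complex.norm_real, Real.norm_eq_abs]
      field_simp [abs_pos.2 hc]
  refine ⟨K, fun x hx => ?_⟩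
  have h1 := (le_abs_self _).trans (hK x hx)
  rw [Real.exp_neg] at h1
  exact (mul_inv_le_iff₀ (Real.exp_pos _)).1 h1

namespace IsSolOn

variable {q Q f g u u' : ℝ → ℂ}

theorem even_of_deriv_zero (hq : Continuous q) (hqe : ∀ x, q (-x) = q x)
    (h : IsSolOn Set.univ q f g) (h0 : g 0 = 0) : ∀ x, f (-x) = f x := fun x =>
  ((h.comp_neg hqe).unique hq h (Set.mem_univ 0) (Set.mem_univ x) (by simp) (by simp [h0])).1

theorem odd_of_apply_zero (hq : Continuous q) (hqe : ∀ x, q (-x) = q x)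
    (h : IsSolOn Set.univ q f g) (h0 : f 0 = 0) : ∀ x, f (-x) = -f x := fun x => by
  have := ((h.comp_neg hqe).unique hq (h.const_mul (-1)) (Set.mem_univ 0) (Set.mem_univ x)
    (by simp [h0]) (by simp)).1
  simpa using this

/-- A real solution that decays at infinity, for an eventually periodic potential, is eventually
multiplied by a contraction factor under translation by one period. -/
theorem exists_multiplier_of_tendsto_zero (hq : Continuous q) {N : ℝ}
    (hper : ∀ x ≥ N, q (x + 1) = q x) (hu : IsSolOn Set.univ q u u')
    (hur : ∀ x, starRingEnd ℂ (u x) = u x ∧ starRingEnd ℂ (u' x) = u' x)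
    (hlim : Filter.Tendsto u Filter.atTop (nhds 0)) (hlim' : Filter.Tendsto u' Filter.atTop (nhds 0))
    (hne : ∀ x, u x ≠ 0 ∨ u' x ≠ 0) :
    ∃ c : ℝ, c ≠ 0 ∧ |c| < 1 ∧ ∀ x ≥ N, u (x + 1) = c * u x ∧ u' (x + 1) = c * u' x := by
  have huN : IsSolOn (Set.Ici N) q u u' := hu.mono (Set.subset_univ _)
  have hsh : IsSolOn (Set.Ici N) q (fun x => u (x + 1)) (fun x => u' (x + 1)) :=
    huN.comp_add_one (fun x hx => Set.mem_Ici.2 (by linarith [Set.mem_Ici.1 hx])) hper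
  have hNN : N ∈ Set.Ici N := Set.self_mem_Ici
  have hshift : Filter.Tendsto (fun x : ℝ => x + 1) Filter.atTop Filter.atTop :=
    Filter.tendsto_atTop_add_const_right _ 1 Filter.tendsto_id
  -- The Wronskian of `u` and its translate is constant on the periodic half-line and tends to zero.
  have hW : u N * u' (N + 1) - u' N * u (N + 1) = 0 := by
    have h1 : Filter.Tendsto (fun x => u x * u' (x + 1) - u' x * u (x + 1)) Filter.atTop
        (nhds 0) := by
      simpa using (hlim.mul (hlim'.comp hshift)).sub (hlim'.mul (hlim.comp hshift))
    refine tendsto_nhds_unique (tendsto_const_nhds.congr' ?_) h1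
    filter_upwards [Filter.eventually_ge_atTop N] with x hx
    exact (huN.wronskian_eq hsh hNN hx).symm
  obtain ⟨c, hc0, hc1⟩ : ∃ c : ℂ, u (N + 1) = c * u N ∧ u' (N + 1) = c * u' N := by
    rcases hne N with h | h
    · refine ⟨u (N + 1) / u N, by field_simp, ?_⟩
      field_simp
      linear_combination hW
    · refine ⟨u' (N + 1) / u' N, ?_, by field_simp⟩
      field_simp
      linear_combination -hW
  have hcr : starRingEnd ℂ c = c := by
    have e0 := congrArg (starRingEnd ℂ) hc0
    have e1 := congrArg (starRingEnd ℂ) hc1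
    rw [map_mul, (hur _).1, (hur _).1, hc0] at e0
    rw [map_mul, (hur _).2, (hur _).2, hc1] at e1
    rcases hne N with h | h
    · exact (mul_right_cancel₀ h e0).symm
    · exact (mul_right_cancel₀ h e1).symm
  obtain ⟨c, rfl⟩ := Complex.conj_eq_iff_real.1 hcr
  have hmul : ∀ x ≥ N, u (x + 1) = c * u x ∧ u' (x + 1) = c * u' x := fun x hx =>
    hsh.unique hq (huN.const_mul c) hNN hx hc0 hc1
  have hc : c ≠ 0 := by
    rintro rfl
    rcases hne (N + 1) with h | h
    · exact h (by simp [hc0])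
    · exact h (by simp [hc1])
  refine ⟨c, hc, ?_, hmul⟩
  have hpow : ∀ n : ℕ, u (N + n) = (c : ℂ) ^ n * u N ∧ u' (N + n) = (c : ℂ) ^ n * u' N := fun n => by
    induction n with
    | zero => simp
    | succ n ih =>
      have := hmul (N + n) (by simp)
      push_cast
      rw [← add_assoc, this.1, this.2, ih.1, ih.2]
      exact ⟨by ring, by ring⟩
  have hN : Filter.Tendsto (fun n : ℕ => N + (n : ℝ)) Filter.atTop Filter.atTop :=
    Filter.tendsto_atTop_add_const_left _ N tendsto_natCast_atTop_atTop
  have hpow0 : Filter.Tendsto (fun n : ℕ => (c : ℂ) ^ n) Filter.atTop (nhds 0) := by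
    rcases hne N with h | h
    · have := ((hlim.comp hN).div_const (u N)).congr fun n => by
        show u (N + n) / u N = (c : ℂ) ^ n
        rw [(hpow n).1]
        field_simp
      simpa using this
    · have := ((hlim'.comp hN).div_const (u' N)).congr fun n => by
        show u' (N + n) / u' N = (c : ℂ) ^ n
        rw [(hpow n).2]
        field_simp
      simpa using this
  simpa using (tendsto_pow_atTop_nhds_zero_iff_norm_lt_one.1 hpow0)

/-- Floquet dichotomy: in the presence of a decaying real solution `u`, the periodic equation has
multipliers `μ` and `μ⁻¹` with `|μ| > 1`, the solution `u` decays like `|μ|^{-x}` and no solution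
grows faster than `|μ|^x`. -/
theorem exists_floquet (hq : Continuous q) (hQ : Continuous Q) (hQper : ∀ x, Q (x + 1) = Q x)
    (hQe : ∀ x, Q (-x) = Q x) {N : ℝ} (hN : 0 ≤ N) (hqQ : ∀ x ≥ N, q x = Q x)
    (hu : IsSolOn Set.univ q u u')
    (hur : ∀ x, starRingEnd ℂ (u x) = u x ∧ starRingEnd ℂ (u' x) = u' x)
    (hlim : Filter.Tendsto u Filter.atTop (nhds 0)) (hlim' : Filter.Tendsto u' Filter.atTop (nhds 0))
    (hne : ∀ x, u x ≠ 0 ∨ u' x ≠ 0) :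
    ∃ μ : ℝ, 1 < |μ| ∧
      (∃ y y', IsSolOn Set.univ Q y y' ∧ y ≠ 0 ∧ ∀ x, y (x + 1) = μ * y x) ∧
      (∃ y y', IsSolOn Set.univ Q y y' ∧ y ≠ 0 ∧ ∀ x, y (x + 1) = (μ⁻¹ : ℝ) * y x) ∧
      (∃ K, ∀ x ≥ 0, ‖u x‖ ≤ K * Real.exp (-Real.log |μ| * x) ∧
        ‖u' x‖ ≤ K * Real.exp (-Real.log |μ| * x)) ∧
      ∀ v v', IsSolOn Set.univ q v v' → ∃ K, ∀ x ≥ 0, ‖v x‖ ≤ K * Real.exp (Real.log |μ| * x) ∧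
        ‖v' x‖ ≤ K * Real.exp (Real.log |μ| * x) := by
  obtain ⟨c, hc, hc1, hmul⟩ := exists_multiplier_of_tendsto_zero hq
    (fun x hx => by rw [hqQ x hx, hqQ (x + 1) (by linarith), hQper]) hu hur hlim hlim' hne
  have hcC : (c : ℂ) ≠ 0 := by exact_mod_cast hc
  have hNN : N ∈ Set.Ici N := Set.self_mem_Ici
  have hlog : Real.log |c⁻¹| = -Real.log |c| := by rw [abs_inv, Real.log_inv]
  -- `y` continues the tail of `u` to the whole line as a solution of the periodic equation; its
  -- reflection then has multiplier `c⁻¹`, because `Q` is even.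
  obtain ⟨y, y', hy, hy0, hy1⟩ := exists_of_continuous hQ N (u N) (u' N)
  have hyu : ∀ x ≥ N, y x = u x ∧ y' x = u' x := fun x hx =>
    (hy.mono (Set.subset_univ (Set.Ici N))).unique hQ
      ((hu.mono (Set.subset_univ (Set.Ici N))).congr_potential hqQ) hNN hx hy0 hy1
  have hymul : ∀ x, y (x + 1) = c * y x ∧ y' (x + 1) = c * y' x := fun x => by
    refine (hy.comp_add_one (fun _ _ => trivial) fun x _ => hQper x).unique hQ (hy.const_mul c)
      (Set.mem_univ N) (Set.mem_univ x) ?_ ?_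
    · rw [(hyu (N + 1) (by linarith)).1, (hmul N le_rfl).1, hy0]
    · rw [(hyu (N + 1) (by linarith)).2, (hmul N le_rfl).2, hy1]
  have hyne : y ≠ 0 := fun h0 => by
    have hd := (hy N trivial).1
    rw [h0] at hd
    have h1 : y' N = 0 := hd.unique (hasDerivAt_const N (0 : ℂ))
    rcases hne N with h | h
    · exact h (by rw [← hy0, h0]; rfl)
    · exact h (by rw [← hy1, h1])
  have hz := hy.comp_neg hQe
  have hzmul : ∀ x, y (-(x + 1)) = (c⁻¹ : ℝ) * y (-x) ∧ -y' (-(x + 1)) = (c⁻¹ : ℝ) * -y' (-x) :=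
    fun x => by
      have := hymul (-(x + 1))
      rw [show -(x + 1) + 1 = -x by ring] at this
      rw [this.1, this.2]
      push_cast
      exact ⟨by field_simp, by field_simp⟩
  -- Up to the factor `-2` this is the Wronskian of `y` and its reflection. Were it zero, `y` would
  -- be even or odd, hence have both multipliers `c` and `c⁻¹`, contradicting `c² < 1`.
  have hW : y 0 * y' 0 ≠ 0 := fun h0 => by
    have hpar : ∃ σ : ℂ, ∀ x, y (-x) = σ * y x := by
      rcases mul_eq_zero.1 h0 with h | h
      · exact ⟨-1, fun x => by rw [hy.odd_of_apply_zero hQ hQe h x]; ring⟩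
      · exact ⟨1, fun x => by rw [hy.even_of_deriv_zero hQ hQe h x]; ring⟩
    obtain ⟨σ, hσ⟩ := hpar
    have hc2 : (1 - (c : ℂ) ^ 2) ≠ 0 := by
      have : c ^ 2 < 1 := (sq_lt_one_iff_abs_lt_one c).2 hc1
      exact_mod_cast (by linarith : (0 : ℝ) < 1 - c ^ 2).ne'
    refine hyne (funext fun x => ?_)
    have h1 := (hzmul (-x)).1
    rw [hσ (-x + 1), neg_neg, (hymul (-x)).1, hσ x] at h1
    have hσ2 := hσ (-x)
    rw [neg_neg, hσ x] at hσ2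
    push_cast at h1
    field_simp at h1
    have h2 : (1 - (c : ℂ) ^ 2) * y x = 0 := by
      linear_combination -h1 - (c : ℂ) ^ 2 * hσ2
    exact (mul_eq_zero.1 h2).resolve_left hc2
  obtain ⟨K₁, hK₁⟩ := exists_norm_le_exp_of_multiplier hy.continuous le_rfl hc
    fun x _ => (hymul x).1
  obtain ⟨K₂, hK₂⟩ := exists_norm_le_exp_of_multiplier hy.continuous_deriv le_rfl hc
    fun x _ => (hymul x).2
  obtain ⟨K₃, hK₃⟩ := exists_norm_le_exp_of_multiplier hz.continuous le_rfl (inv_ne_zero hc)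
    fun x _ => (hzmul x).1
  obtain ⟨K₄, hK₄⟩ := exists_norm_le_exp_of_multiplier hz.continuous_deriv le_rfl
    (inv_ne_zero hc) fun x _ => (hzmul x).2
  have hlogc : Real.log |c| < 0 := Real.log_neg (abs_pos.2 hc) hc1
  refine ⟨c⁻¹, ?_, ⟨_, _, hz, ?_, fun x => (hzmul x).1⟩,
    ⟨y, y', hy, hyne, fun x => by rw [inv_inv]; exact (hymul x).1⟩, ?_, ?_⟩
  · rw [abs_inv]
    exact (one_lt_inv₀ (abs_pos.2 hc)).2 hc1
  · exact fun h => hyne (funext fun x => by simpa using congrFun h (-x))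
  · obtain ⟨L₁, hL₁⟩ := exists_norm_le_exp_of_multiplier hu.continuous hN hc
      fun x hx => (hmul x hx).1
    obtain ⟨L₂, hL₂⟩ := exists_norm_le_exp_of_multiplier hu.continuous_deriv hN hc
      fun x hx => (hmul x hx).2
    refine ⟨max L₁ L₂, fun x hx => ?_⟩
    rw [hlog, neg_neg]
    exact ⟨(hL₁ x hx).trans (by gcongr; exact le_max_left _ _),
      (hL₂ x hx).trans (by gcongr; exact le_max_right _ _)⟩
  · intro v v' hv
    obtain ⟨B, hB⟩ := (isCompact_Icc (a := (0 : ℝ)) (b := N)).exists_bound_of_continuousOn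
      hv.continuous.continuousOn
    obtain ⟨B', hB'⟩ := (isCompact_Icc (a := (0 : ℝ)) (b := N)).exists_bound_of_continuousOn
      hv.continuous_deriv.continuousOn
    have hvN : IsSolOn (Set.Ici N) Q v v' :=
      (hv.mono (Set.subset_univ (Set.Ici N))).congr_potential hqQ
    set w := -2 * (y 0 * y' 0) with hw
    have hw0 : w ≠ 0 := mul_ne_zero (by norm_num) hW
    set α := v N * -y' (-N) - v' N * y (-N) with hα
    set β := v N * y' N - v' N * y N with hβ
    -- Expansion of `v` in the basis formed by `y` and its reflection, with constant Wronskians as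
    -- coefficients.
    have hrep : ∀ x ≥ N, v x = w⁻¹ * (α * y x - β * y (-x)) ∧
        v' x = w⁻¹ * (α * y' x - β * -y' (-x)) := fun x hx => by
      have e1 := hy.wronskian_eq hz (Set.mem_univ 0) (Set.mem_univ x)
      have e2 := hvN.wronskian_eq (hz.mono (Set.subset_univ _)) hNN hx
      have e3 := hvN.wronskian_eq (hy.mono (Set.subset_univ _)) hNN hx
      simp only [neg_zero] at e1
      rw [← hα] at e2
      rw [← hβ] at e3
      constructor
      · rw [eq_inv_mul_iff_mul_eq₀ hw0, hw]
        linear_combination y x * e2 - y (-x) * e3 - v x * e1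
      · rw [eq_inv_mul_iff_mul_eq₀ hw0, hw]
        linear_combination y' x * e2 + y' (-x) * e3 - v' x * e1
    have hexp : ∀ x ≥ 0, Real.exp (Real.log |c| * x) ≤ Real.exp (Real.log |c⁻¹| * x) := by
      intro x hx
      rw [hlog]
      gcongr
      linarith
    have h00 : (0 : ℝ) ≤ 0 := le_rfl
    have hK0 : 0 ≤ K₁ ∧ 0 ≤ K₂ := by
      have h1 := (norm_nonneg _).trans (hK₁ 0 h00)
      have h2 := (norm_nonneg _).trans (hK₂ 0 h00)
      simp only [mul_zero, Real.exp_zero, mul_one] at h1 h2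
      exact ⟨h1, h2⟩
    have bound : ∀ (x A₁ A₂ : ℝ) (η ζ : ℂ), 0 ≤ x → 0 ≤ A₁ →
        ‖η‖ ≤ A₁ * Real.exp (Real.log |c| * x) → ‖ζ‖ ≤ A₂ * Real.exp (Real.log |c⁻¹| * x) →
        ‖w⁻¹ * (α * η - β * ζ)‖ ≤
          (‖w⁻¹‖ * (‖α‖ * A₁ + ‖β‖ * A₂)) * Real.exp (Real.log |c⁻¹| * x) := by
      intro x A₁ A₂ η ζ hx hA₁ hη hζ
      have hη' := hη.trans (mul_le_mul_of_nonneg_left (hexp x hx) hA₁)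
      rw [norm_mul, mul_assoc]
      gcongr
      refine (norm_sub_le _ _).trans ?_
      rw [norm_mul, norm_mul, add_mul, mul_assoc, mul_assoc]
      gcongr
    set C := max (max B B') (max (‖w⁻¹‖ * (‖α‖ * K₁ + ‖β‖ * K₃)) (‖w⁻¹‖ * (‖α‖ * K₂ + ‖β‖ * K₄)))
      with hC
    have hC1 : B ≤ C := by simp [hC]
    have hC2 : B' ≤ C := by simp [hC]
    have hC3 : ‖w⁻¹‖ * (‖α‖ * K₁ + ‖β‖ * K₃) ≤ C := (le_max_left _ _).trans (le_max_right _ _)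
    have hC4 : ‖w⁻¹‖ * (‖α‖ * K₂ + ‖β‖ * K₄) ≤ C := (le_max_right _ _).trans (le_max_right _ _)
    refine ⟨C, fun x hx => ?_⟩
    rcases le_total x N with hxN | hxN
    · have hexp1 : 1 ≤ Real.exp (Real.log |c⁻¹| * x) := by
        rw [hlog]
        exact Real.one_le_exp (mul_nonneg (by linarith) hx)
      have hB0 := hB x ⟨hx, hxN⟩
      have hB1 := hB' x ⟨hx, hxN⟩
      have hC0 : 0 ≤ C := (norm_nonneg _).trans (hB0.trans hC1)
      have := le_mul_of_one_le_right hC0 hexp1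
      exact ⟨by linarith, by linarith⟩
    · rw [(hrep x hxN).1, (hrep x hxN).2]
      exact ⟨(bound x K₁ K₃ _ _ hx hK0.1 (hK₁ x hx) (hK₃ x hx)).trans (by gcongr),
        (bound x K₂ K₄ _ _ hx hK0.2 (hK₂ x hx) (hK₄ x hx)).trans (by gcongr)⟩

end IsSolOn

/-! ### Size, derivative and variation of `Θ` near the bound state energy. -/

/-- The principal root has nonnegative real part, so `|√z + √E| ≥ √E`; this makes the estimate valid
for all `z`, even across the branch cut. -/
theorem norm_complex_sqrt_sub_le {E : ℝ} (hE : 0 < E) (z : ℂ) :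
    ‖Complex.sqrt z - Complex.sqrt E‖ ≤ ‖z - E‖ / √E := by
  have hs : 0 < √E := Real.sqrt_pos.2 hE
  have hsq : ∀ w : ℂ, Complex.sqrt w ^ 2 = w := fun w => by
    simp [Complex.sqrt]
  have hE' : Complex.sqrt E = √E := by
    rw [Complex.sqrt_of_nonneg (by exact_mod_cast hE.le), Complex.ofReal_re]
  have hre : √E ≤ ‖Complex.sqrt z + Complex.sqrt E‖ := by
    refine le_trans ?_ (Complex.re_le_norm _)
    rw [hE', Complex.add_re, Complex.ofReal_re, Complex.sqrt, Complex.cpow_inv_two_re]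
    linarith [Real.sqrt_nonneg ((‖z‖ + z.re) / 2)]
  rw [le_div_iff₀ hs]
  calc _ ≤ ‖Complex.sqrt z - Complex.sqrt E‖ * ‖Complex.sqrt z + Complex.sqrt E‖ := by gcongr
    _ = ‖z - E‖ := by
      rw [← norm_mul]
      congr 1
      linear_combination hsq z - hsq E

theorem differentiableAt_complex_sqrt {z : ℂ} (hz : z ∈ Complex.slitPlane) :
    DifferentiableAt ℂ Complex.sqrt z :=
  (differentiableAt_id.cpow_const hz : DifferentiableAt ℂ (fun w : ℂ => w ^ (2⁻¹ : ℂ)) z)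

theorem mem_slitPlane_of_norm_sub_lt {E : ℝ} {z : ℂ} (hz : ‖z - E‖ < E) :
    z ∈ Complex.slitPlane := by
  refine Or.inl ?_
  have := (Complex.abs_re_le_norm (z - E)).trans_lt hz
  rw [Complex.sub_re, Complex.ofReal_re] at this
  linarith [(abs_lt.1 this).1]

/-- For real `w`, `w'` the terms `w'` and `-s w` are the real and imaginary parts, so they cannot
cancel. -/
theorem norm_add_norm_le_of_real {w w' : ℂ} (hw : starRingEnd ℂ w = w)
    (hw' : starRingEnd ℂ w' = w') {s : ℝ} (hs : 0 < s) :
    ‖w'‖ + ‖w‖ ≤ (1 + 1 / s) * ‖w' - Complex.I * s * w‖ := by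
  obtain ⟨w, rfl⟩ := Complex.conj_eq_iff_real.1 hw
  obtain ⟨w', rfl⟩ := Complex.conj_eq_iff_real.1 hw'
  have h1 := Complex.abs_re_le_norm ((w' : ℂ) - Complex.I * s * w)
  have h2 := Complex.abs_im_le_norm ((w' : ℂ) - Complex.I * s * w)
  simp only [Complex.sub_re, Complex.sub_im, Complex.mul_re, Complex.mul_im, Complex.ofReal_re,
    Complex.ofReal_im, Complex.I_re, Complex.I_im] at h1 h2
  ring_nf at h1 h2
  rw [Complex.norm_real, Complex.norm_real, Real.norm_eq_abs, Real.norm_eq_abs, add_mul, one_mul]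
  have h3 : |w| ≤ 1 / s * ‖(w' : ℂ) - Complex.I * s * w‖ := by
    rw [one_div, le_inv_mul_iff₀ hs]
    have : |-(s * w)| = s * |w| := by rw [abs_neg, abs_mul, abs_of_pos hs]
    rw [← this]
    convert h2 using 2
  refine add_le_add ?_ h3
  convert h1 using 2

namespace IsSolFamily

variable {q : ℝ → ℂ} {a b : ℂ} {U G : ℂ → ℝ → ℂ}

theorem outgoingTheta_eq (h : IsSolFamily q a b U G) (M : ℝ) (z : ℂ) :
    outgoingTheta U M z = G z M - Complex.I * Complex.sqrt z * U z M := by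
  rw [outgoingTheta, (h.sol z M trivial).1.deriv]

theorem differentiableAt_outgoingTheta (h : IsSolFamily q a b U G) (hq : Continuous q) {M : ℝ}
    (hM : 0 ≤ M) {z : ℂ} (hz : z ∈ Complex.slitPlane) :
    DifferentiableAt ℂ (outgoingTheta U M) z := by
  rw [funext (h.outgoingTheta_eq M)]
  have hd := h.differentiable_param hq hM
  exact (hd.2 z).fun_sub
    (((differentiableAt_complex_sqrt hz).const_mul Complex.I).fun_mul (hd.1 z))

variable {E κ K : ℝ} {r r' : ℝ → ℂ}

theorem norm_outgoingTheta_le (h : IsSolFamily q a b U G) (hE : 0 < E)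
    (hUK : ∀ x ≥ 0, ‖U E x‖ ≤ K * Real.exp (-κ * x) ∧ ‖G E x‖ ≤ K * Real.exp (-κ * x))
    {M : ℝ} (hM : 0 ≤ M) :
    ‖outgoingTheta U M E‖ ≤ K * (1 + √E) * Real.exp (-κ * M) := by
  rw [h.outgoingTheta_eq, Complex.sqrt_of_nonneg (by exact_mod_cast hE.le), Complex.ofReal_re]
  refine (_root_.norm_sub_le _ _).trans ?_
  rw [norm_mul, norm_mul, Complex.norm_I, one_mul, Complex.norm_real,
    Real.norm_of_nonneg (Real.sqrt_nonneg E)]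
  calc _ ≤ K * Real.exp (-κ * M) + √E * (K * Real.exp (-κ * M)) := by
        have h1 := (hUK M hM).1
        have h2 := (hUK M hM).2
        gcongr
    _ = _ := by ring

/-- The derivative of `Θ` at a bound state energy grows at least like `e^{κM}`. -/
theorem exists_le_norm_deriv_outgoingTheta (h : IsSolFamily q a b U G) (hq : Continuous q)
    (hqr : ∀ x, starRingEnd ℂ (q x) = q x) (ha : starRingEnd ℂ a = a) (hb : starRingEnd ℂ b = b)
    (hE : 0 < E) (hκ : 0 < κ) (hK : 0 < K)
    (hUK : ∀ x ≥ 0, ‖U E x‖ ≤ K * Real.exp (-κ * x) ∧ ‖G E x‖ ≤ K * Real.exp (-κ * x))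
    (hr : IsSolOn Set.univ (fun x => q x - E) r r') (hW : U E 0 * r' 0 - G E 0 * r 0 = 1) :
    ∃ c > 0, ∀ᶠ M in Filter.atTop, c * Real.exp (κ * M) ≤ ‖deriv (outgoingTheta U M) E‖ := by
  have hU := h.sol E
  have hUc := hU.continuous
  have hUr : ∀ x, starRingEnd ℂ (U E x) = U E x := fun x => by
    simpa using (h.conj_apply hq hqr ha hb E x).1
  set s := √E with hs
  have hs0 : 0 < s := Real.sqrt_pos.2 hE
  have hsE : Complex.sqrt E = s := by
    rw [Complex.sqrt_of_nonneg (by exact_mod_cast hE.le), Complex.ofReal_re]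
  obtain ⟨d, hd⟩ : ∃ d, HasDerivAt Complex.sqrt d (E : ℂ) :=
    ⟨_, (differentiableAt_complex_sqrt
      (mem_slitPlane_of_norm_sub_lt (E := E) (by simpa using hE))).hasDerivAt⟩
  set J := ∫ t in (0 : ℝ)..1, ‖U E t‖ ^ 2 with hJ
  have hJ0 : 0 < J := by
    refine intervalIntegral.integral_pos one_pos (by fun_prop) (fun t _ => by positivity) ?_
    by_contra! hcon
    have hz : ∀ t ∈ Set.Icc (0 : ℝ) 1, U E t = 0 := fun t ht => by
      have := hcon t ht
      exact norm_eq_zero.1 (pow_eq_zero_iff two_ne_zero |>.1 (le_antisymm this (by positivity)))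
    have hG : G E (1 / 2) = 0 := by
      refine (hU (1 / 2) trivial).1.unique ?_
      refine (hasDerivAt_const (1 / 2 : ℝ) (0 : ℂ)).congr_of_eventuallyEq ?_
      filter_upwards [Icc_mem_nhds (by norm_num : (0 : ℝ) < 1 / 2) (by norm_num : (1 / 2 : ℝ) < 1)]
        with t ht using hz t ht
    have := hU.wronskian_eq hr (Set.mem_univ 0) (Set.mem_univ (1 / 2))
    rw [hW, hG, hz _ (by norm_num)] at this
    simp at this
  have hlow : ∀ M ≥ 1, J * Real.exp (κ * M) / (K * (1 + 1 / s)) - ‖d‖ * K ≤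
      ‖deriv (outgoingTheta U M) E‖ := fun M hM => by
    have hM0 : (0 : ℝ) ≤ M := by linarith
    obtain ⟨hw, hw'⟩ := h.hasDerivAt_param hU hr hW hM0
    set w := U E M * (∫ t in (0 : ℝ)..M, U E t * r t) - r M * ∫ t in (0 : ℝ)..M, U E t * U E t
    set w' := G E M * (∫ t in (0 : ℝ)..M, U E t * r t) - r' M * ∫ t in (0 : ℝ)..M, U E t * U E t
    -- `z ↦ U z M` commutes with conjugation, so its derivative at a real point is real.
    have hwr : starRingEnd ℂ w = w := by
      have h1 := hw.conj_conj
      rw [Complex.conj_ofReal] at h1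
      refine h1.unique (hw.congr_of_eventuallyEq (Filter.Eventually.of_forall fun z => ?_))
      simpa using (h.conj_apply hq hqr ha hb (starRingEnd ℂ z) M).1
    have hwr' : starRingEnd ℂ w' = w' := by
      have h1 := hw'.conj_conj
      rw [Complex.conj_ofReal] at h1
      refine h1.unique (hw'.congr_of_eventuallyEq (Filter.Eventually.of_forall fun z => ?_))
      simpa using (h.conj_apply hq hqr ha hb (starRingEnd ℂ z) M).2
    have hder : deriv (outgoingTheta U M) E =
        (w' - Complex.I * s * w) - Complex.I * d * U E M := by
      rw [funext (h.outgoingTheta_eq M), (hw'.fun_sub ((hd.const_mul Complex.I).fun_mul hw)).deriv,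
        hsE]
      ring
    have hWM := hU.wronskian_eq hr (Set.mem_univ 0) (Set.mem_univ M)
    rw [hW] at hWM
    have hintegral : ∫ t in (0 : ℝ)..M, U E t * U E t = ((∫ t in (0 : ℝ)..M, ‖U E t‖ ^ 2 : ℝ) : ℂ) := by
      rw [← intervalIntegral.integral_ofReal]
      refine intervalIntegral.integral_congr fun t _ => ?_
      have := Complex.mul_conj' (U E t)
      rw [hUr t] at this
      simpa using this
    have hJM : J ≤ ∫ t in (0 : ℝ)..M, ‖U E t‖ ^ 2 := by
      refine intervalIntegral.integral_mono_interval le_rfl zero_le_one hM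
        (Filter.Eventually.of_forall fun t => by positivity)
        ((by fun_prop : Continuous _).intervalIntegrable _ _)
    -- Lagrange's identity, the source of the growth: the decaying factors `U E M`, `G E M` must be
    -- compensated by `w`, `w'`.
    have hlag : U E M * w' - G E M * w = -∫ t in (0 : ℝ)..M, U E t * U E t := by
      linear_combination -(∫ t in (0 : ℝ)..M, U E t * U E t) * hWM
    have hJw : J ≤ K * Real.exp (-κ * M) * ((1 + 1 / s) * ‖w' - Complex.I * s * w‖) := by
      calc J ≤ ‖U E M * w' - G E M * w‖ := by
            rw [hlag, norm_neg, hintegral, Complex.norm_real]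
            exact hJM.trans (le_abs_self _)
        _ ≤ ‖U E M‖ * ‖w'‖ + ‖G E M‖ * ‖w‖ := by
            refine (_root_.norm_sub_le _ _).trans ?_
            rw [norm_mul, norm_mul]
        _ ≤ K * Real.exp (-κ * M) * (‖w'‖ + ‖w‖) := by
            rw [mul_add]
            have h1 := (hUK M hM0).1
            have h2 := (hUK M hM0).2
            gcongr
        _ ≤ _ := by
            have := norm_add_norm_le_of_real hwr hwr' hs0
            gcongr
    have h1 : J * Real.exp (κ * M) / (K * (1 + 1 / s)) ≤ ‖w' - Complex.I * s * w‖ := by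
      rw [div_le_iff₀ (by positivity)]
      calc J * Real.exp (κ * M) ≤ K * Real.exp (-κ * M) *
            ((1 + 1 / s) * ‖w' - Complex.I * s * w‖) * Real.exp (κ * M) := by gcongr
        _ = ‖w' - Complex.I * s * w‖ * (K * (1 + 1 / s)) := by
            rw [neg_mul, Real.exp_neg]
            field_simp
    have h2 : ‖Complex.I * d * U E M‖ ≤ ‖d‖ * K := by
      rw [norm_mul, norm_mul, Complex.norm_I, one_mul]
      have h3 : Real.exp (-κ * M) ≤ 1 := by
        rw [Real.exp_le_one_iff]
        nlinarith
      have h4 := (hUK M hM0).1.trans (mul_le_of_le_one_right hK.le h3)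
      gcongr
    rw [hder]
    have := norm_sub_norm_le (w' - Complex.I * s * w) (Complex.I * d * U E M)
    linarith
  set c₀ := J / (K * (1 + 1 / s)) with hc₀
  have hc₀0 : 0 < c₀ := by positivity
  refine ⟨c₀ / 2, by positivity, ?_⟩
  have hexp : Filter.Tendsto (fun M => c₀ / 2 * Real.exp (κ * M)) Filter.atTop Filter.atTop :=
    (Real.tendsto_exp_atTop.comp (Filter.tendsto_id.const_mul_atTop hκ)).const_mul_atTop
      (by positivity)
  filter_upwards [Filter.eventually_ge_atTop 1, hexp.eventually_ge_atTop (‖d‖ * K)] with M hM hM'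
  have e : J * Real.exp (κ * M) / (K * (1 + 1 / s)) = c₀ * Real.exp (κ * M) := by
    rw [hc₀]; ring
  have := hlow M hM
  rw [e] at this
  linarith

/-- Near a bound state energy `Θ` varies at most like `e^{κM}`. -/
theorem exists_norm_outgoingTheta_sub_le (h : IsSolFamily q a b U G)
    (hE : 0 < E) (hκ : 0 < κ) (hK : 0 < K)
    (hUK : ∀ x ≥ 0, ‖U E x‖ ≤ K * Real.exp (-κ * x) ∧ ‖G E x‖ ≤ K * Real.exp (-κ * x))
    (hr : IsSolOn Set.univ (fun x => q x - E) r r') (hW : U E 0 * r' 0 - G E 0 * r 0 = 1)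
    (hrK : ∀ x ≥ 0, ‖r x‖ ≤ K * Real.exp (κ * x) ∧ ‖r' x‖ ≤ K * Real.exp (κ * x)) :
    ∃ C > 0, ∃ ε > 0, ε ≤ E ∧ ∀ M ≥ 1, ∀ z : ℂ, ‖z - E‖ ≤ ε / M →
      ‖outgoingTheta U M z - outgoingTheta U M E‖ ≤ C * Real.exp (κ * M) * ‖z - E‖ := by
  set s := √E with hs
  have hs0 : 0 < s := Real.sqrt_pos.2 hE
  have hUc := (h.sol E).continuous
  set C₁ := 4 * K ^ 2 * (K / (2 * κ)) with hC₁
  have hC₁0 : 0 < C₁ := by positivity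
  -- In `ε`, the bound `1 / (4 * K ^ 2)` provides the smallness needed for absorption in
  -- `norm_sub_le`; the bound `E` controls `√z` and keeps the open disc in the slit plane.
  refine ⟨C₁ + (s + E / s) * C₁ + K / s, by positivity, min (1 / (4 * K ^ 2)) E, by positivity,
    min_le_right _ _, fun M hM z hz => ?_⟩
  have hM0 : 0 < M := by linarith
  have hz1 : ‖z - E‖ * (2 * K ^ 2) * M ≤ 1 / 2 := by
    have h1 : ‖z - E‖ * M ≤ 1 / (4 * K ^ 2) :=
      ((le_div_iff₀ hM0).1 hz).trans (min_le_left _ _)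
    calc ‖z - E‖ * (2 * K ^ 2) * M = ‖z - E‖ * M * (2 * K ^ 2) := by ring
      _ ≤ 1 / (4 * K ^ 2) * (2 * K ^ 2) := by gcongr
      _ = 1 / 2 := by field_simp; norm_num
  have hz2 : ‖z - E‖ ≤ E := by
    refine hz.trans ((div_le_self (by positivity) hM).trans (min_le_right _ _))
  have hexp1 : Real.exp (-κ * M) ≤ Real.exp (κ * M) := by
    gcongr
    linarith
  obtain ⟨b1, b2⟩ := h.norm_sub_le (h.sol E) hr hW (K := K) (K₁ := K / (2 * κ)) hκ.le
    (fun x hx => hUK x hx.1) (fun x hx => hrK x hx.1)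
    (fun x hx => by
      have hprim : ∀ t ∈ Set.uIcc 0 x, HasDerivAt (fun t => -(K / (2 * κ)) * Real.exp (-2 * κ * t))
          (K * Real.exp (-2 * κ * t)) t := fun t _ =>
        ((((hasDerivAt_id' t).const_mul (-2 * κ)).exp).const_mul _).congr_deriv
          (by field_simp)
      calc ∫ t in (0 : ℝ)..x, ‖U E t‖ * Real.exp (-κ * t)
          ≤ ∫ t in (0 : ℝ)..x, K * Real.exp (-2 * κ * t) := by
            refine intervalIntegral.integral_mono_on hx.1
              ((by fun_prop : Continuous _).intervalIntegrable _ _)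
              ((by fun_prop : Continuous _).intervalIntegrable _ _) fun t ht => ?_
            calc _ ≤ K * Real.exp (-κ * t) * Real.exp (-κ * t) := by
                  gcongr
                  exact (hUK t ht.1).1
              _ = K * Real.exp (-2 * κ * t) := by
                  rw [mul_assoc, ← Real.exp_add]
                  ring_nf
        _ = K / (2 * κ) - K / (2 * κ) * Real.exp (-2 * κ * x) := by
            rw [intervalIntegral.integral_eq_sub_of_hasDerivAt hprim
              ((by fun_prop : Continuous _).intervalIntegrable _ _)]
            simp only [mul_zero, Real.exp_zero]
            ring
        _ ≤ K / (2 * κ) := by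
            have : 0 ≤ K / (2 * κ) * Real.exp (-2 * κ * x) := by positivity
            linarith)
    hz1 (x := M) ⟨hM0.le, le_rfl⟩
  rw [← hC₁] at b1 b2
  have hsq := norm_complex_sqrt_sub_le hE z
  have hsE : ‖Complex.sqrt E‖ = s := by
    rw [Complex.sqrt_of_nonneg (by exact_mod_cast hE.le), Complex.ofReal_re, Complex.norm_real,
      Real.norm_of_nonneg hs0.le]
  have hsz : ‖Complex.sqrt z‖ ≤ s + E / s := by
    calc _ ≤ ‖Complex.sqrt E‖ + ‖Complex.sqrt z - Complex.sqrt E‖ := norm_le_norm_add_norm_sub' _ _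
      _ ≤ s + E / s := by
          rw [hsE]
          gcongr
          exact hsq.trans (by gcongr)
  rw [h.outgoingTheta_eq, h.outgoingTheta_eq]
  calc _ = ‖(G z M - G E M) - Complex.I * (Complex.sqrt z * (U z M - U E M)) -
        Complex.I * ((Complex.sqrt z - Complex.sqrt E) * U E M)‖ := by ring_nf
    _ ≤ ‖G z M - G E M‖ + ‖Complex.sqrt z‖ * ‖U z M - U E M‖ +
        ‖Complex.sqrt z - Complex.sqrt E‖ * ‖U E M‖ := by
        refine (_root_.norm_sub_le _ _).trans (add_le_add ((_root_.norm_sub_le _ _).trans ?_) ?_)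
        · simp
        · simp
    _ ≤ C₁ * ‖z - E‖ * Real.exp (κ * M) + (s + E / s) * (C₁ * ‖z - E‖ * Real.exp (κ * M)) +
        ‖z - E‖ / s * (K * Real.exp (κ * M)) := by
        have h3 : ‖U E M‖ ≤ K * Real.exp (κ * M) := (hUK M hM0.le).1.trans (by gcongr)
        gcongr
    _ = _ := by ring

/-- The resonance near a bound state energy, for large truncation radius. -/
theorem exists_hasUniqueRootNear (h : IsSolFamily q a b U G) (hq : Continuous q)
    (hqr : ∀ x, starRingEnd ℂ (q x) = q x) (ha : starRingEnd ℂ a = a) (hb : starRingEnd ℂ b = b)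
    (hE : 0 < E) (hκ : 0 < κ) (hK : 0 < K)
    (hUK : ∀ x ≥ 0, ‖U E x‖ ≤ K * Real.exp (-κ * x) ∧ ‖G E x‖ ≤ K * Real.exp (-κ * x))
    (hr : IsSolOn Set.univ (fun x => q x - E) r r') (hW : U E 0 * r' 0 - G E 0 * r 0 = 1)
    (hrK : ∀ x ≥ 0, ‖r x‖ ≤ K * Real.exp (κ * x) ∧ ‖r' x‖ ≤ K * Real.exp (κ * x)) :
    ∃ C > 0, ∀ᶠ M in Filter.atTop, ∀ k, 0 < k → k ≤ κ →
      HasUniqueRootNear (outgoingTheta U M) E (1 / M ^ 2 * Real.exp (-k * M))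
        (C * M * Real.exp (-4 * κ * M)) := by
  obtain ⟨c, hc, hlow⟩ := h.exists_le_norm_deriv_outgoingTheta hq hqr ha hb hE hκ hK hUK hr hW
  obtain ⟨C₂, hC₂, ε, hε, hεE, hup⟩ := h.exists_norm_outgoingTheta_sub_le hE hκ hK hUK hr hW hrK
  set C₃ := 8 * C₂ / (ε * c) with hC₃
  set C₄ := K * (1 + √E) / c with hC₄
  have hC₃0 : 0 < C₃ := by positivity
  have hC₄0 : 0 < C₄ := by positivity
  have hpoly : Filter.Tendsto (fun M : ℝ => 2 * C₄ * (M ^ 2 * Real.exp (-κ * M))) Filter.atTop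
      (nhds 0) := by
    have h1 := (tendsto_rpow_mul_exp_neg_mul_atTop_nhds_zero 2 κ hκ).const_mul (2 * C₄)
    simpa using h1
  refine ⟨4 * C₃ * C₄ ^ 2, by positivity, ?_⟩
  filter_upwards [hlow, Filter.eventually_ge_atTop 1, Filter.eventually_gt_atTop (4 / ε),
    Filter.eventually_ge_atTop (2 * C₃), hpoly.eventually_le_const one_pos]
    with M hD hM1 hMε hMC hMp k hk hkκ
  have hM0 : 0 < M := by linarith
  have hR : 0 < ε / M := by positivity
  have hek : Real.exp (-k * M) ≤ 1 := by
    rw [Real.exp_le_one_iff]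
    nlinarith
  have hekpos := Real.exp_pos (-k * M)
  have hDpos : 0 < ‖deriv (outgoingTheta U M) E‖ := lt_of_lt_of_le (by positivity) hD
  have hA : ‖outgoingTheta U M E / deriv (outgoingTheta U M) E‖ ≤ C₄ * Real.exp (-2 * κ * M) := by
    rw [norm_div, div_le_iff₀ hDpos]
    calc ‖outgoingTheta U M E‖ ≤ K * (1 + √E) * Real.exp (-κ * M) :=
          h.norm_outgoingTheta_le hE hUK hM0.le
      _ = C₄ * Real.exp (-2 * κ * M) * (c * Real.exp (κ * M)) := by
          rw [show -κ * M = -2 * κ * M + κ * M by ring, Real.exp_add, hC₄]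
          field_simp
      _ ≤ _ := by gcongr
  -- On radius `ε / M` the variation is of order `e^{κM} / M`, so Cauchy's bound divided by the size
  -- of the derivative is `η = O(M)`: this is the origin of the factor `M` in the error at rate `κ`.
  have hroot := hasUniqueRootNear_of_norm_sub_le (f := outgoingTheta U M) (E := E) (R := ε / M)
    (K := C₂ * Real.exp (κ * M) * (ε / M)) (r := 1 / M ^ 2 * Real.exp (-k * M)) (η := C₃ * M) hR
    (fun z hz => (h.differentiableAt_outgoingTheta hq hM0.le (mem_slitPlane_of_norm_sub_lt
      ((mem_ball_iff_norm.1 hz).trans_le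
        ((div_le_self hε.le hM1).trans hεE)))).differentiableWithinAt)
    (fun z hz => by
      have hz' := (mem_ball_iff_norm.1 hz).le
      exact (hup M hM1 z hz').trans (by gcongr))
    (norm_pos_iff.1 hDpos) (by positivity) ?_ ?_ ?_ ?_
  · obtain ⟨h1, zs, h2, h3, h4, h5⟩ := hroot
    refine ⟨h1, zs, h2, h3, h4, h5.trans ?_⟩
    calc _ ≤ 4 * (C₃ * M) * (C₄ * Real.exp (-2 * κ * M)) ^ 2 := by gcongr
      _ = 4 * C₃ * C₄ ^ 2 * M * Real.exp (-4 * κ * M) := by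
          rw [mul_pow, ← Real.exp_nat_mul]
          push_cast
          ring_nf
  · calc 1 / M ^ 2 * Real.exp (-k * M) ≤ 1 / M ^ 2 * 1 := by gcongr
      _ < ε / M / 4 := by
          have : 4 < M * ε := (div_lt_iff₀ hε).1 hMε
          rw [mul_one, div_div, div_lt_div_iff₀ (by positivity) (by positivity)]
          nlinarith
  · calc 8 * (C₂ * Real.exp (κ * M) * (ε / M)) / (ε / M) ^ 2 =
          C₃ * M * (c * Real.exp (κ * M)) := by
          rw [hC₃]
          field_simp
      _ ≤ _ := by gcongr
  · calc C₃ * M * (1 / M ^ 2 * Real.exp (-k * M)) ≤ C₃ * M * (1 / M ^ 2 * 1) := by gcongr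
      _ = C₃ / M := by field_simp
      _ ≤ 1 / 2 := by
          rw [div_le_div_iff₀ hM0 two_pos]
          linarith
  · refine hA.trans ?_
    have h1 : Real.exp (-2 * κ * M) ≤ Real.exp (-κ * M) * Real.exp (-k * M) := by
      rw [← Real.exp_add]
      gcongr
      nlinarith
    calc C₄ * Real.exp (-2 * κ * M) ≤ C₄ * (Real.exp (-κ * M) * Real.exp (-k * M)) := by gcongr
      _ = 2 * C₄ * (M ^ 2 * Real.exp (-κ * M)) * (1 / M ^ 2 * Real.exp (-k * M) / 2) := by
          field_simp
      _ ≤ 1 * (1 / M ^ 2 * Real.exp (-k * M) / 2) := by gcongr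
      _ = _ := one_mul _

end IsSolFamily

/-! ### Return to the Schrödinger equation and conclusion. -/

theorem SolvesSchrodinger.isSolOn {V : ℝ → ℝ} {z : ℂ} {u : ℝ → ℂ} (h : SolvesSchrodinger V z u) :
    IsSolOn Set.univ (fun x => (V x : ℂ) - z) u (deriv u) := fun x _ => by
  have h2 : ContDiff ℝ 1 (deriv u) := ContDiff.deriv' (by simpa [one_add_one_eq_two] using h.1)
  refine ⟨(h.1.differentiable (by norm_num) x).hasDerivAt,
    (h2.differentiable one_ne_zero x).hasDerivAt.congr_deriv ?_⟩
  linear_combination -h.2 x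

theorem IsSolOn.solvesSchrodinger {V : ℝ → ℝ} (hV : Continuous V) {z : ℂ} {f g : ℝ → ℂ}
    (h : IsSolOn Set.univ (fun x => (V x : ℂ) - z) f g) : SolvesSchrodinger V z f := by
  have h1 : deriv f = g := funext fun x => (h x trivial).1.deriv
  have h2 : deriv g = fun x => ((V x : ℂ) - z) * f x := funext fun x => (h x trivial).2.deriv
  have hfc := h.continuous
  refine ⟨?_, fun x => ?_⟩
  · rw [← one_add_one_eq_two, contDiff_succ_iff_deriv, h1, contDiff_one_iff_deriv, h2]
    refine ⟨fun x => (h x trivial).1.differentiableAt, by simp,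
      fun x => (h x trivial).2.differentiableAt, by fun_prop⟩
  · rw [h1, h2]
    ring

section Potential

variable {V Vper Vdef : ℝ → ℝ} {ρ : ℝ}

/-- No regularity or symmetry of `Vper` is assumed: both are inherited from `V` by translating
beyond the defect. -/
theorem periodic_eq_add_natCast (hdecomp : ∀ x, V x = Vper x + Vdef x)
    (hper : ∀ x, Vper (x + 1) = Vper x) (hdef : ∀ x, ρ < |x| → Vdef x = 0) {x : ℝ} {n : ℕ}
    (hn : ρ < x + n) : Vper x = V (x + n) := by
  rw [hdecomp, hdef _ (hn.trans_le (le_abs_self _)), add_zero]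
  have := Function.Periodic.nat_mul (f := Vper) hper n x
  rw [mul_one] at this
  exact this.symm

theorem continuous_periodic_part (hV : Continuous V) (hdecomp : ∀ x, V x = Vper x + Vdef x)
    (hper : ∀ x, Vper (x + 1) = Vper x) (hdef : ∀ x, ρ < |x| → Vdef x = 0) :
    Continuous Vper := continuous_iff_continuousAt.2 fun x => by
  obtain ⟨n, hn⟩ := exists_nat_gt (ρ - x + 1)
  refine ContinuousAt.congr (f := fun y => V (y + n)) (by fun_prop) ?_
  filter_upwards [lt_mem_nhds (sub_one_lt x)] with y hy
  exact (periodic_eq_add_natCast hdecomp hper hdef (by linarith)).symm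

theorem even_periodic_part (heven : ∀ x, V (-x) = V x) (hdecomp : ∀ x, V x = Vper x + Vdef x)
    (hper : ∀ x, Vper (x + 1) = Vper x) (hdef : ∀ x, ρ < |x| → Vdef x = 0) (x : ℝ) :
    Vper (-x) = Vper x := by
  obtain ⟨n, hn⟩ := exists_nat_gt (ρ - x)
  rw [periodic_eq_add_natCast hdecomp hper hdef (by linarith : ρ < x + n), ← heven, hdecomp,
    hdef _ (by rw [abs_neg]; exact (by linarith : ρ < x + n).trans_le (le_abs_self _)), add_zero]
  have := Function.Periodic.nat_mul (f := Vper) hper n (-(x + n))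
  rw [mul_one] at this
  rw [← this]
  congr 1
  ring

end Potential

/-- For an even bounded potential, a square-integrable solution has one vanishing Cauchy datum at
the origin. -/
theorem IsSolOn.mul_deriv_zero_eq_zero_of_memLp_two {q f g : ℝ → ℂ} (hq : Continuous q)
    (hqe : ∀ x, q (-x) = q x) (h : IsSolOn Set.univ q f g) {Q : ℝ} (hQ : ∀ t ≥ 0, ‖q t‖ ≤ Q)
    (hf : MeasureTheory.MemLp f 2 MeasureTheory.volume) : f 0 * g 0 = 0 := by
  have hn := h.comp_neg hqe
  obtain ⟨h1, h2⟩ := h.tendsto_zero_of_memLp_two hq hQ hf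
  obtain ⟨h3, h4⟩ := hn.tendsto_zero_of_memLp_two hq hQ
    (hf.comp_measurePreserving (MeasureTheory.Measure.measurePreserving_neg _))
  -- The Wronskian of `f` and its reflection is the constant `-2 f(0) g(0)`, and it tends to zero.
  have hlim := (h1.mul h4).sub (h2.mul h3)
  have := tendsto_nhds_unique (hlim.congr fun x =>
    h.wronskian_eq hn (Set.mem_univ 0) (Set.mem_univ x)) tendsto_const_nhds
  simp only [neg_zero, mul_zero, sub_zero] at this
  linear_combination (1 / 2) * this

theorem mul_exp_neg_mul_le {δ : ℝ} (hδ : 0 < δ) (M : ℝ) : M * Real.exp (-δ * M) ≤ 1 / δ := by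
  have h1 : δ * M ≤ Real.exp (δ * M) := by linarith [Real.add_one_le_exp (δ * M)]
  rw [neg_mul, Real.exp_neg, ← div_eq_mul_inv, div_le_div_iff₀ (Real.exp_pos _) hδ]
  linarith

theorem HasUniqueRootNear.mono {Θ : ℂ → ℂ} {E r err err' : ℝ} (h : HasUniqueRootNear Θ E r err)
    (he : err ≤ err') : HasUniqueRootNear Θ E r err' := by
  obtain ⟨h0, zs, h1, h2, h3, h4⟩ := h
  exact ⟨h0, zs, h1, h2, h3, h4.trans he⟩

theorem theorem1
    (V Vper Vdef : ℝ → ℝ) (ρ : ℝ) (hρ : 0 ≤ ρ)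
    (hV : ContDiff ℝ ∞ V)
    (hdecomp : ∀ x : ℝ, V x = Vper x + Vdef x)
    (hper : ∀ x : ℝ, Vper (x + 1) = Vper x)
    (hdef : ∀ x : ℝ, ρ < |x| → Vdef x = 0)
    (heven : ∀ x : ℝ, V (-x) = V x)
    (E : ℝ) (hE : 0 < E) (Φ : ℝ → ℂ) (hΦ : IsBoundState V E Φ) :
    ∃ (a b : ℂ) (u : ℂ → ℝ → ℂ) (μ κ : ℝ),
      -- the bound state is even or odd, which fixes the initial data `(a, b)`
      ((Function.Even Φ ∧ a = 1 ∧ b = 0) ∨ (Function.Odd Φ ∧ a = 0 ∧ b = 1)) ∧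
      -- `u z` is the solution of the initial value problem
      (∀ z : ℂ, SolvesSchrodinger V z (u z) ∧ u z 0 = a ∧ deriv (u z) 0 = b) ∧
      -- the Floquet multipliers `μ, μ⁻¹` at energy `E` are real, and `κ = log |μ| > 0`
      1 < |μ| ∧ IsFloquetMultiplier Vper E μ ∧ IsFloquetMultiplier Vper E μ⁻¹ ∧
      κ = Real.log |μ| ∧
      -- every rate `k < κ`, with error `O(e^{-4kM})`
      (∀ k : ℝ, 0 < k → k < κ →
        ∃ M₀ C : ℝ, ρ < M₀ ∧ ∀ M : ℝ, M₀ ≤ M →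
          HasUniqueRootNear (outgoingTheta u M) E
            (1 / M ^ 2 * Real.exp (-k * M)) (C * Real.exp (-4 * k * M))) ∧
      -- the rate `κ` itself, with error `O(M e^{-4κM})`
      (∃ M₀ C : ℝ, ρ < M₀ ∧ ∀ M : ℝ, M₀ ≤ M →
          HasUniqueRootNear (outgoingTheta u M) E
            (1 / M ^ 2 * Real.exp (-κ * M)) (C * M * Real.exp (-4 * κ * M))) := by

  have hVc := hV.continuous
  have hVpc := continuous_periodic_part hVc hdecomp hper hdef
  have hVpe := even_periodic_part heven hdecomp hper hdef
  -- The defect is only known to vanish strictly beyond `ρ`, so the closed half-line starts further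
  -- out.
  set N := ρ + 1 with hN
  have hN0 : 0 ≤ N := by positivity
  have hVV : ∀ x ≥ N, V x = Vper x := fun x hx => by
    rw [hdecomp, hdef x (lt_of_lt_of_le (by linarith) (le_abs_self x)), add_zero]
  have hVC : Continuous fun x => (V x : ℂ) := by fun_prop
  have hqc : Continuous fun x => (V x : ℂ) - E := by fun_prop
  have hqe : ∀ x, (V (-x) : ℂ) - E = V x - E := fun x => by rw [heven]
  obtain ⟨Q, hQ⟩ := exists_bound_of_eventually_periodic (φ := fun x => ‖(V x : ℂ) - E‖)
    (by fun_prop) hN0 fun x hx => by rw [hVV x hx, hVV (x + 1) (by linarith), hper]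
  have hQ' : ∀ x ≥ 0, ‖(V x : ℂ) - E‖ ≤ Q := fun x hx => by simpa using hQ x hx
  obtain ⟨hΦS, hΦL, hΦ0⟩ := hΦ
  have hΦs := hΦS.isSolOn
  have hdata : Φ 0 ≠ 0 ∨ deriv Φ 0 ≠ 0 := by
    by_contra! h0
    exact hΦ0 (funext fun x => (hΦs.eq_zero hqc (Set.mem_univ 0) (Set.mem_univ x) h0.1 h0.2).1)
  -- `c` rescales `Φ` to the prescribed data `(a, b)`; `(r₀, r₁)` are data of a second solution
  -- whose Wronskian with `U E` is `1`.
  obtain ⟨a, b, c, r₀, r₁, hpar, ha, hb, hc, hΦa, hΦb, hab⟩ : ∃ a b c r₀ r₁ : ℂ,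
      ((Function.Even Φ ∧ a = 1 ∧ b = 0) ∨ (Function.Odd Φ ∧ a = 0 ∧ b = 1)) ∧
      starRingEnd ℂ a = a ∧ starRingEnd ℂ b = b ∧ c ≠ 0 ∧ a = c⁻¹ * Φ 0 ∧ b = c⁻¹ * deriv Φ 0 ∧
      a * r₁ - b * r₀ = 1 := by
    rcases mul_eq_zero.1 (hΦs.mul_deriv_zero_eq_zero_of_memLp_two hqc hqe hQ' hΦL) with h0 | h0
    · have h1 := hdata.resolve_left (not_not.2 h0)
      exact ⟨0, 1, deriv Φ 0, -1, 0, Or.inr ⟨hΦs.odd_of_apply_zero hqc hqe h0, rfl, rfl⟩, by simp,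
        by simp, h1, by simp [h0], by simp [h1], by simp⟩
    · have h1 := hdata.resolve_right (not_not.2 h0)
      exact ⟨1, 0, Φ 0, 0, 1, Or.inl ⟨hΦs.even_of_deriv_zero hqc hqe h0, rfl, rfl⟩, by simp,
        by simp, h1, by simp [h1], by simp [h0], by simp⟩
  obtain ⟨U, G, hUG⟩ := exists_isSolFamily hVC a b
  have hUE := hUG.sol E
  have hUΦ : ∀ x, U E x = c⁻¹ * Φ x ∧ G E x = c⁻¹ * deriv Φ x := fun x =>
    hUE.unique hqc (hΦs.const_mul c⁻¹) (Set.mem_univ 0) (Set.mem_univ x)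
      (by rw [hUG.apply_zero, hΦa]) (by rw [hUG.deriv_zero, hΦb])
  obtain ⟨hlim, hlim'⟩ := hΦs.tendsto_zero_of_memLp_two hqc hQ' hΦL
  have hUlim : Filter.Tendsto (U E) Filter.atTop (nhds 0) := by
    simpa using (hlim.const_mul c⁻¹).congr fun x => (hUΦ x).1.symm
  have hGlim : Filter.Tendsto (G E) Filter.atTop (nhds 0) := by
    simpa using (hlim'.const_mul c⁻¹).congr fun x => (hUΦ x).2.symm
  have hne : ∀ x, U E x ≠ 0 ∨ G E x ≠ 0 := fun x => by
    by_contra! h0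
    have := hUE.eq_zero hqc (Set.mem_univ x) (Set.mem_univ 0) h0.1 h0.2
    rw [hUG.apply_zero, hUG.deriv_zero] at this
    simp [this.1, this.2] at hab
  have hreal : ∀ x, starRingEnd ℂ (U E x) = U E x ∧ starRingEnd ℂ (G E x) = G E x := fun x => by
    simpa using hUG.conj_apply hVC (fun x => Complex.conj_ofReal _) ha hb E x
  obtain ⟨μ, hμ, ⟨y₁, y₁', hy₁, hy₁0, hy₁μ⟩, ⟨y₂, y₂', hy₂, hy₂0, hy₂μ⟩, ⟨K₁, hK₁⟩, hgrow⟩ :=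
    IsSolOn.exists_floquet hqc (Q := fun x => (Vper x : ℂ) - E) (by fun_prop)
      (fun x => by rw [hper]) (fun x => by rw [hVpe]) hN0 (fun x hx => by rw [hVV x hx]) hUE hreal
      hUlim hGlim hne
  obtain ⟨r, r', hr, hr0, hr1⟩ := IsSolOn.exists_of_continuous hqc 0 r₀ r₁
  obtain ⟨K₂, hK₂⟩ := hgrow r r' hr
  have hκ : 0 < Real.log |μ| := Real.log_pos hμ
  have hK₁K : K₁ ≤ max (max K₁ K₂) 1 := (le_max_left _ _).trans (le_max_left _ _)
  have hK₂K : K₂ ≤ max (max K₁ K₂) 1 := (le_max_right _ _).trans (le_max_left _ _)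
  obtain ⟨C, hC, hroot⟩ := hUG.exists_hasUniqueRootNear hVC (fun x => Complex.conj_ofReal _) ha hb
    hE hκ (K := max (max K₁ K₂) 1) (by positivity)
    (fun x hx => ⟨(hK₁ x hx).1.trans (by gcongr), (hK₁ x hx).2.trans (by gcongr)⟩) hr
    (by rw [hUG.apply_zero, hUG.deriv_zero, hr0, hr1, hab])
    (fun x hx => ⟨(hK₂ x hx).1.trans (by gcongr), (hK₂ x hx).2.trans (by gcongr)⟩)
  obtain ⟨M₀, hM₀⟩ := Filter.eventually_atTop.1 (hroot.and (Filter.eventually_gt_atTop ρ))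
  refine ⟨a, b, U, μ, Real.log |μ|, hpar,
    fun z => ⟨(hUG.sol z).solvesSchrodinger hVc, hUG.apply_zero z, ?_⟩, hμ,
    ⟨y₁, hy₁.solvesSchrodinger hVpc, hy₁0, hy₁μ⟩, ⟨y₂, hy₂.solvesSchrodinger hVpc, hy₂0, hy₂μ⟩,
    rfl, fun k hk hkκ => ?_, ?_⟩
  · rw [(hUG.sol z 0 trivial).1.deriv, hUG.deriv_zero]
  -- The surplus decay `e^{-δM}` at rate `κ` over rate `k` absorbs the factor `M`.
  · set δ := 4 * (Real.log |μ| - k) with hδ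
    have hδ0 : 0 < δ := by linarith
    refine ⟨M₀, C * (1 / δ), (hM₀ M₀ le_rfl).2, fun M hM =>
      ((hM₀ M hM).1 k hk hkκ.le).mono ?_⟩
    calc C * M * Real.exp (-4 * Real.log |μ| * M) =
          C * (M * Real.exp (-δ * M)) * Real.exp (-4 * k * M) := by
          rw [show -4 * Real.log |μ| * M = -δ * M + -4 * k * M by rw [hδ]; ring, Real.exp_add]
          ring
      _ ≤ C * (1 / δ) * Real.exp (-4 * k * M) := by
          have := mul_exp_neg_mul_le hδ0 M
          gcongr
  · exact ⟨M₀, C, (hM₀ M₀ le_rfl).2, fun M hM => (hM₀ M hM).1 _ hκ le_rfl⟩
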